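/- \textbf{Theorem.} Let a reference qubit $R$ purify a qubit secret $S$ in a (in general mixed) state $\rho_S$, i.e. let $|\phi\rangle_{RS}$ be a pure state. An encoding maps $|\phi\rangle_{RS}$ to a pure state of $R$, of $N$ players (one qubit each) and of $s$ extra players (one qubit each) who purify the $N$ players and are discarded. Call an encoding a $\gamma$-approximate $((b,g))$ quantum ramp secret-sharing scheme for the $N$ players if, for every secret $|\phi\rangle_{RS}$ and every set $C$ of players, $I(R:C)\le\gamma$ when $|C|\le b$ (secrecy), and $I(R:C)\ge I(R:S)-\gamma$ when $|C|\ge g$ (recoverability), where $I(X:Y)=S(X)+S(Y)-S(XY)$ is the quantum mutual information in bits. For every $\gamma>0$ there is $\varepsilon>0$, depending on $\gamma$ only, such that for every $\delta>0$ there is $n_0$ such that, for all $N,s\ge 0$ with $N+s\ge n_0$, a Haar-random scrambling unitary $U$ gives, with probability at least $1-\delta$, a $\gamma$-approximate $$\left(\left(\tfrac{N+s}{2}-\varepsilon,\ \tfrac{N+s}{2}+\varepsilon\right)\right)$$ quantum ramp secret-sharing scheme for the $N$ players, in each of the following two settings. (1) The secret occupies one of the $N+s$ qubits, the other $N+s-1$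 qubits start in an arbitrary fixed pure state, $U$ is Haar-distributed on the unitary group of all $N+s$ qubits, and the $s$ extra players are discarded afterwards. (2) The secret occupies one of the $N$ qubits; the other $N-1$ qubits start in a mixed state with $2^s$ equal non-zero eigenvalues, so that exactly $s$ extra qubits (the memory) are needed to purify it, with which they are in a fixed pure state; $U$ is Haar-distributed on the unitary group of the $N$ qubits and does not act on the memory. -/

import Mathlib

open MeasureTheory

noncomputable section

/-! ### Registers, partial traces, entropies (in bits) -/

/-- Computational basis labels of a register consisting of one qubit for every element of `P`. -/
abbrev Qubits (P : Type) : Type := P → Fin 2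

/-- `v` is a unit vector of the Hilbert space `ℂ^X`, that is, a pure state. -/
def IsUnitVector {X : Type} [Fintype X] (v : X → ℂ) : Prop :=
  ∑ x, ‖v x‖ ^ 2 = 1

/-- Partial trace over the second factor. -/
def traceSnd {X Y : Type} [Fintype Y] (ρ : Matrix (X × Y) (X × Y) ℂ) : Matrix X X ℂ :=
  fun x x' => ∑ y, ρ (x, y) (x', y)

/-- Partial trace over the first factor. -/
def traceFst {X Y : Type} [Fintype X] (ρ : Matrix (X × Y) (X × Y) ℂ) : Matrix Y Y ℂ :=
  fun y y' => ∑ x, ρ (x, y) (x, y')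

open Classical in
/-- The von Neumann entropy `-∑ λ log₂ λ` over the eigenvalues `λ` of a density matrix `ρ`
(density matrices are Hermitian; the value at other matrices is irrelevant). -/
def vonNeumannEntropy {X : Type} [Fintype X] (ρ : Matrix X X ℂ) : ℝ :=
  if h : ρ.IsHermitian then (∑ i, Real.negMulLog (h.eigenvalues i)) / Real.log 2 else 0

/-- The quantum mutual information `I(X:Y) = S(X) + S(Y) - S(XY)` of a joint state of `X` and
`Y`, in bits. -/
def mutualInfo {X Y : Type} [Fintype X] [Fintype Y] (ρ : Matrix (X × Y) (X × Y) ℂ) : ℝ :=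
  vonNeumannEntropy (traceSnd ρ) + vonNeumannEntropy (traceFst ρ) - vonNeumannEntropy ρ

/-- The density matrix `|φ⟩⟨φ|` of a pure state. -/
def pureDensity {X : Type} (φ : X → ℂ) : Matrix X X ℂ :=
  fun x x' => φ x * star (φ x')

/-! ### The state held by a set of players -/

/-- Given a joint pure state of a reference `R`, the players `P` and the purifying players `Q`,
discard the purifying players: the joint density matrix of `R` and `P`. -/
def discardPurifier {R P Q : Type} [Fintype Q] [DecidableEq Q]
    (Ψ : R × Qubits P × Qubits Q → ℂ) : Matrix (R × Qubits P) (R × Qubits P) ℂ :=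
  fun u v => ∑ q : Qubits Q, Ψ (u.1, u.2, q) * star (Ψ (v.1, v.2, q))

/-- The basis label of all players which is `u` on the set `C` and `z` off it. -/
def mergeLabels {P : Type} [DecidableEq P] (C : Finset P)
    (u : Qubits {p // p ∈ C}) (z : Qubits {p // p ∉ C}) : Qubits P :=
  fun p => if h : p ∈ C then u ⟨p, h⟩ else z ⟨p, h⟩

/-- The joint density matrix of the reference `R` and of the players in `C`: all the other
players are traced out. -/
def restrictPlayers {R P : Type} [Fintype P] [DecidableEq P] (C : Finset P)
    (ρ : Matrix (R × Qubits P) (R × Qubits P) ℂ) :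
    Matrix (R × Qubits {p // p ∈ C}) (R × Qubits {p // p ∈ C}) ℂ :=
  fun u v => ∑ z : Qubits {p // p ∉ C},
    ρ (u.1, mergeLabels C u.2 z) (v.1, mergeLabels C v.2 z)

/-! ### Approximate quantum ramp secret sharing -/

/-- An encoding of a qubit secret `S` for the players `P`, with purifying players `Q`: it sends
the purification `φ` of a secret (a pure state of the reference qubit `R` and of `S`, in this
order) to a pure state of `R`, the players, and the purifying players. -/
abbrev Encoding (P Q : Type) : Type :=
  (Fin 2 × Fin 2 → ℂ) → (Fin 2 × Qubits P × Qubits Q → ℂ)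

/-- `γ`-approximate `((b, g))` quantum ramp secret sharing among the players `P`, who do not hold
the systems `Q`. For every (in general mixed) secret `ρ_S`, purified by `R`:
secrecy `I(R:C) ≤ γ` for every set `C` of at most `b` players, and
recoverability `I(R:C) ≥ I(R:S) - γ` for every set `C` of at least `g` players. -/
def IsApproxRampScheme {P Q : Type} [Fintype P] [DecidableEq P] [Fintype Q] [DecidableEq Q]
    (E : Encoding P Q) (b g γ : ℝ) : Prop :=
  ∀ φ : Fin 2 × Fin 2 → ℂ, IsUnitVector φ → ∀ C : Finset P,
    ((C.card : ℝ) ≤ b → mutualInfo (restrictPlayers C (discardPurifier (E φ))) ≤ γ) ∧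
    (g ≤ (C.card : ℝ) →
      mutualInfo (pureDensity φ) - γ ≤ mutualInfo (restrictPlayers C (discardPurifier (E φ))))

/-! ### Haar scrambling -/

instance unitaryGroupCompactSpace (n : Type) [Fintype n] [DecidableEq n] :
    CompactSpace (Matrix.unitaryGroup n ℂ) := by
  have hc : IsCompact (Set.pi Set.univ fun _ : n => Set.pi Set.univ fun _ : n =>
      Metric.closedBall (0 : ℂ) 1) :=
    isCompact_univ_pi fun _ => isCompact_univ_pi fun _ => isCompact_closedBall 0 1
  suffices h : IsCompact (unitary (Matrix n n ℂ) : Set (Matrix n n ℂ)) from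
    isCompact_iff_compactSpace.mp h
  have hcl : IsClosed (unitary (Matrix n n ℂ) : Set (Matrix n n ℂ)) := isClosed_unitary
  refine IsCompact.of_isClosed_subset (X := Matrix n n ℂ) hc hcl ?_
  intro U hU i _ j _
  simpa using entry_norm_bound_of_unitary hU i j

instance unitaryGroupMeasurableSpace (n : Type) [Fintype n] [DecidableEq n] :
    MeasurableSpace (Matrix.unitaryGroup n ℂ) := borel _

instance unitaryGroupBorelSpace (n : Type) [Fintype n] [DecidableEq n] :
    BorelSpace (Matrix.unitaryGroup n ℂ) := ⟨rfl⟩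

/-- The Haar probability measure on the unitary group of `ℂ^n`. -/
def haarUnitary (n : Type) [Fintype n] [DecidableEq n] : Measure (Matrix.unitaryGroup n ℂ) :=
  Measure.haarMeasure ⊤

instance haarUnitaryIsProbabilityMeasure (n : Type) [Fintype n] [DecidableEq n] :
    IsProbabilityMeasure (haarUnitary n) :=
  ⟨by simpa [haarUnitary] using
    Measure.haarMeasure_self (K₀ := (⊤ : TopologicalSpace.PositiveCompacts
      (Matrix.unitaryGroup n ℂ)))⟩

/-- The scrambled state. The qubits `T` consist of the qubit `a`, which carries the secret, and of
the others, which are in the joint pure state `χ` with a memory `M`; the unitary `U` acts on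
`T` and not on `R` or `M`:  `(I_R ⊗ U_T ⊗ I_M) |φ⟩_{R a} |χ⟩_{(T \ a) M}`. -/
def scrambledState {T M : Type} [Fintype T] [DecidableEq T]
    (a : T) (χ : Qubits {t // t ≠ a} × Qubits M → ℂ) (U : Matrix.unitaryGroup (Qubits T) ℂ)
    (φ : Fin 2 × Fin 2 → ℂ) : Fin 2 × Qubits T × Qubits M → ℂ :=
  fun u => ∑ x : Qubits T,
    (U : Matrix (Qubits T) (Qubits T) ℂ) u.2.1 x * (φ (u.1, x a) * χ (fun t => x t, u.2.2))

/-- Scrambling of the players `P` alone. The qubits of `P` other than the secret qubit `a` start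
in a mixed state, which is purified by the qubits `Q` (the memory); `U` acts on `P` only. -/
def memoryEncoding {P Q : Type} [Fintype P] [DecidableEq P]
    (a : P) (χ : Qubits {p // p ≠ a} × Qubits Q → ℂ)
    (U : Matrix.unitaryGroup (Qubits P) ℂ) : Encoding P Q :=
  fun φ => scrambledState a χ U φ

/-- Scrambling of the players `P` together with the extra players `Q`: all the qubits of `P ⊕ Q`
other than the secret qubit `a` start in a pure state `χ`, and `U` acts on all of `P ⊕ Q`. -/
def jointEncoding {P Q : Type} [Fintype P] [DecidableEq P] [Fintype Q] [DecidableEq Q]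
    (a : P ⊕ Q) (χ : Qubits {t // t ≠ a} → ℂ)
    (U : Matrix.unitaryGroup (Qubits (P ⊕ Q)) ℂ) : Encoding P Q :=
  fun φ u => scrambledState (M := Empty) a (fun y => χ y.1) U φ
    (u.1, Sum.elim u.2.1 u.2.2, Empty.elim)

/-- The pure state `χ` of the registers `B` and `Q` is maximally entangled on the side of `Q`: its
marginal on the qubits `Q` is maximally mixed. Then the marginal on `B` has `2 ^ |Q|` non-zero
eigenvalues, all equal, so it has entropy `|Q|` bits and needs exactly `|Q|` qubits to be
purified. -/
def IsMaximallyEntangledWith {B Q : Type} [Fintype B] [DecidableEq B] [Fintype Q] [DecidableEq Q]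
    (χ : Qubits B × Qubits Q → ℂ) : Prop :=
  traceFst (pureDensity χ) = (((2 : ℂ) ^ Fintype.card Q)⁻¹) • (1 : Matrix (Qubits Q) (Qubits Q) ℂ)

end

/-!
# Haar-random scrambling gives approximate quantum ramp secret sharing

Encoding half of a maximally entangled pair by the random isometry gives an amplitude matrix `A`
whose rows are indexed by the reference and a kept register `X` and whose columns are indexed by the
discarded register `Z`. Everything follows from one operator bound: if `A * Aᴴ ≤ c / |X|` with `c`
close to `1` (`IsDominated`), then for every secret the state of the reference and `X` is at most
`c` times the product of its reference marginal with the maximally mixed state. Gibbs' inequality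
(`neg_sum_mul_log_le_vonNeumannEntropy`) turns this into a lower bound on its entropy, hence into
`I(R:X) ≤ log₂ c` (`mutualInfo_le_of_isDominated`), which is secrecy. The global state is pure, so
the same bound for the register complementary to `X`, memory included, gives
`I(R:X) ≥ I(R:S) - log₂ c` (`le_mutualInfo_of_isDominated_swap`), which is recoverability.

The operator bound holds with overwhelming probability for every set of at most `n / 2 - ε` qubits,
`n = N + s`. For a fixed vector `ξ`, the squared length of the image of `ξ` under `A` is the
`weight` of `U`: the squared length of its projection on a family of orthogonal matrices of equal
norm. Up to an additive constant the weight is an eigenfunction of averaging `f (V U)` over the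
rotations `V = cos θ ± sin θ P` by anti-Hermitian Pauli strings `P`. Invariance of Haar measure makes `(U, V U)` an
exchangeable pair, and in the limit `θ → 0` one finds that each moment of the weight is at most
`mean * (1 + 4 k / L)` times the preceding one (`integral_weight_pow_succ_le`), where `L` is the
dimension of the discarded register. Markov's inequality for a moment of order proportional to `L`
makes the failure probability exponentially small in `L`.

A union bound over a net of the unit ball of `ℂ^(2 D)`, where `D` is the dimension of the kept
register, costs a factor exponential in `D` (`haar_exists_codeAmplitude_gt_le`). Since
`D * L = 2 ^ n` and `L / D ≥ 4 ^ ε`, a constant `ε` makes the first exponent win, and a second union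
bound over the at most `2 ^ n` sets of players is affordable because `L ≥ 2 ^ (n / 2)`
(`exists_threshold`).

Both settings are instances of scrambling qubits `T` entangled with a memory `M`: jointly scrambled
players have `M` empty, and in the other setting the maximally mixed marginal on the memory is what
makes the input vectors `inputVector` orthogonal with equal norms.
-/

noncomputable section

open Matrix

/-! ### Anti-Hermitian Pauli strings -/

/-- The sign `(-1)^(b · y)` of the Pauli string `Z^b` at the computational basis state `y`. -/
def pauliSign {P : Type} [Fintype P] (b y : Qubits P) : ℂ :=
  ∏ p, if b p = 1 ∧ y p = 1 then -1 else 1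

lemma pauliSign_add {P : Type} [Fintype P] (b y a : Qubits P) :
    pauliSign b (y + a) = pauliSign b y * pauliSign b a := by
  unfold pauliSign
  rw [← Finset.prod_mul_distrib]
  refine Finset.prod_congr rfl fun p _ => ?_
  rw [Pi.add_apply]
  generalize b p = i
  generalize y p = j
  generalize a p = k
  fin_cases i <;> fin_cases j <;> fin_cases k <;> simp

lemma pauliSign_eq {P : Type} [Fintype P] (b y : Qubits P) :
    pauliSign b y = 1 ∨ pauliSign b y = -1 := by
  unfold pauliSign
  refine Finset.prod_induction _ (fun z : ℂ => z = 1 ∨ z = -1) ?_ (Or.inl rfl) ?_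
  · rintro _ _ (rfl | rfl) (rfl | rfl) <;> simp
  · intro p _
    split_ifs <;> simp

lemma pauliSign_mul_self {P : Type} [Fintype P] (b y : Qubits P) :
    pauliSign b y * pauliSign b y = 1 := by
  rcases pauliSign_eq b y with h | h <;> simp [h]

lemma star_pauliSign {P : Type} [Fintype P] (b y : Qubits P) :
    star (pauliSign b y) = pauliSign b y := by
  rcases pauliSign_eq b y with h | h <;> simp [h]

lemma qubits_add_self {P : Type} (a : Qubits P) : a + a = 0 := by
  funext p
  rw [Pi.add_apply]
  generalize a p = k
  fin_cases k <;> rfl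

lemma qubits_eq_add_iff {P : Type} (x y a : Qubits P) : x = y + a ↔ y = x + a := by
  constructor <;> rintro rfl <;> rw [add_assoc, qubits_add_self, add_zero]

lemma sum_pauliSign_mul {P : Type} [Fintype P] [DecidableEq P] (y y' : Qubits P) :
    ∑ b : Qubits P, pauliSign b y * pauliSign b y' =
      if y = y' then (Fintype.card (Qubits P) : ℂ) else 0 := by
  unfold pauliSign
  simp_rw [← Finset.prod_mul_distrib]
  have := Finset.prod_univ_sum (κ := fun _ : P => Fin 2) (fun _ => Finset.univ)
    (fun p t => (if t = 1 ∧ y p = 1 then (-1 : ℂ) else 1) * (if t = 1 ∧ y' p = 1 then -1 else 1))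
  rw [Fintype.piFinset_univ] at this
  rw [← this]
  have key : ∀ p, (∑ t : Fin 2, (if t = 1 ∧ y p = 1 then (-1 : ℂ) else 1) *
      (if t = 1 ∧ y' p = 1 then -1 else 1)) = if y p = y' p then 2 else 0 := by
    intro p
    rw [Fin.sum_univ_two]
    generalize y p = i
    generalize y' p = j
    fin_cases i <;> fin_cases j <;> norm_num
  simp_rw [key]
  split_ifs with h
  · subst h
    simp
  · obtain ⟨p, hp⟩ := Function.ne_iff.mp h
    exact Finset.prod_eq_zero (Finset.mem_univ p) (if_neg hp)

/-- The Pauli string `X^a Z^b`, multiplied by `i` when it is Hermitian: the phase is chosen so that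
the matrix is always anti-Hermitian, which makes `cos θ + sin θ · skewPauli j` unitary. -/
def skewPauli {P : Type} [Fintype P] [DecidableEq P] (j : Qubits P × Qubits P) :
    Matrix (Qubits P) (Qubits P) ℂ :=
  fun x y => if x = y + j.1 then
    (if pauliSign j.2 j.1 = 1 then Complex.I else 1) * pauliSign j.2 y else 0

lemma skewPauli_conjTranspose {P : Type} [Fintype P] [DecidableEq P] (j : Qubits P × Qubits P) :
    (skewPauli j)ᴴ = -skewPauli j := by
  ext x y
  rw [conjTranspose_apply, Matrix.neg_apply]
  unfold skewPauli
  by_cases h : x = y + j.1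
  · rw [if_pos h, if_pos ((qubits_eq_add_iff _ _ _).1 h), star_mul', star_pauliSign, h,
      pauliSign_add]
    rcases pauliSign_eq j.2 j.1 with h1 | h1
    · simp [h1]
    · have : ¬ ((-1 : ℂ) = 1) := by norm_num
      simp [h1, this]
  · rw [if_neg h, if_neg fun h' => h ((qubits_eq_add_iff _ _ _).1 h')]
    simp

lemma skewPauli_mul_self {P : Type} [Fintype P] [DecidableEq P] (j : Qubits P × Qubits P) :
    skewPauli j * skewPauli j = -1 := by
  ext x y
  rw [Matrix.mul_apply, Finset.sum_eq_single (y + j.1)]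
  · unfold skewPauli
    rw [add_assoc, qubits_add_self, add_zero, if_pos rfl, Matrix.neg_apply, Matrix.one_apply]
    split_ifs with h1 h2 h2
    · rw [pauliSign_add, h2]
      linear_combination (Complex.I * Complex.I) * pauliSign_mul_self j.2 y + Complex.I_mul_I
    · rw [pauliSign_add, (pauliSign_eq j.2 j.1).resolve_left h2]
      linear_combination (-1) * pauliSign_mul_self j.2 y
    · simp
    · simp
  · intro z _ hz
    unfold skewPauli
    simp [hz]
  · simp

lemma sum_skewPauli_mul_star {P : Type} [Fintype P] [DecidableEq P] (x y x' y' : Qubits P) :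
    ∑ j, skewPauli j x y * star (skewPauli j x' y') =
      if x = x' ∧ y = y' then (Fintype.card (Qubits P) : ℂ) else 0 := by
  have key : ∀ a b : Qubits P, skewPauli (a, b) x y * star (skewPauli (a, b) x' y') =
      if x = y + a ∧ x' = y' + a then pauliSign b y * pauliSign b y' else 0 := by
    intro a b
    unfold skewPauli
    by_cases h : x = y + a
    · by_cases h' : x' = y' + a
      · have hc : x = y + a ∧ x' = y' + a := ⟨h, h'⟩
        dsimp only
        rw [if_pos hc, if_pos h, if_pos h', star_mul', star_pauliSign]
        by_cases hs : pauliSign b a = 1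
        · simp only [hs, if_true, RCLike.star_def, Complex.conj_I]
          linear_combination (-(pauliSign b y * pauliSign b y')) * Complex.I_mul_I
        · simp [hs]
      · simp [h']
    · simp [h]
  rw [Fintype.sum_prod_type]
  simp_rw [key]
  have h2 : ∀ a : Qubits P, (∑ b, if x = y + a ∧ x' = y' + a then
      pauliSign b y * pauliSign b y' else 0) =
      if a = x + y then (if x = x' ∧ y = y' then (Fintype.card (Qubits P) : ℂ) else 0) else 0 := by
    intro a
    have h3 : x = y + a ↔ a = x + y := by
      rw [add_comm y a, qubits_eq_add_iff]
    by_cases h : x = y + a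
    · rw [if_pos (h3.1 h)]
      by_cases hy : y = y'
      · subst hy
        by_cases hx : x = x'
        · subst hx
          simp [h]
          have := sum_pauliSign_mul y y
          simpa using this
        · have : ¬ (x' = y + a) := fun h' => hx (h.trans h'.symm)
          simp [this, hx]
      · simp only [hy, and_false, if_false]
        split_ifs
        · rw [sum_pauliSign_mul, if_neg hy]
        · simp
    · rw [if_neg fun h' => h (h3.2 h')]
      simp [h]
  simp_rw [h2]
  simp

/-- Parseval's identity for the basis of Pauli strings. -/
lemma sum_norm_trace_mul_skewPauli {P : Type} [Fintype P] [DecidableEq P]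
    (N : Matrix (Qubits P) (Qubits P) ℂ) :
    ((∑ j, ‖trace (N * skewPauli j)‖ ^ 2 : ℝ) : ℂ) =
      Fintype.card (Qubits P) * trace (N * Nᴴ) := by
  have h1 : ∀ j, ((‖trace (N * skewPauli j)‖ ^ 2 : ℝ) : ℂ) =
      ∑ p : Qubits P × Qubits P, ∑ q : Qubits P × Qubits P, (N p.1 p.2 * star (N q.1 q.2)) *
        (skewPauli j p.2 p.1 * star (skewPauli j q.2 q.1)) := by
    intro j
    have : trace (N * skewPauli j) =
        ∑ p : Qubits P × Qubits P, N p.1 p.2 * skewPauli j p.2 p.1 := by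
      simp [trace, Matrix.mul_apply, Fintype.sum_prod_type]
    rw [Complex.ofReal_pow, ← Complex.mul_conj', this, map_sum, Finset.sum_mul_sum]
    refine Finset.sum_congr rfl fun p _ => Finset.sum_congr rfl fun q _ => ?_
    simp
    ring
  rw [Complex.ofReal_sum]
  simp_rw [h1]
  rw [Finset.sum_comm]
  have h2 : ∀ p : Qubits P × Qubits P, (∑ j, ∑ q : Qubits P × Qubits P,
      (N p.1 p.2 * star (N q.1 q.2)) * (skewPauli j p.2 p.1 * star (skewPauli j q.2 q.1))) =
      Fintype.card (Qubits P) * (N p.1 p.2 * star (N p.1 p.2)) := by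
    intro p
    rw [Finset.sum_comm]
    simp_rw [← Finset.mul_sum, sum_skewPauli_mul_star]
    rw [Finset.sum_eq_single p]
    · simp
      ring
    · intro q _ hq
      have : ¬ (p.2 = q.2 ∧ p.1 = q.1) := fun h => hq (Prod.ext h.2.symm h.1.symm)
      simp [this]
    · simp
  simp_rw [h2]
  rw [← Finset.mul_sum]
  simp [trace, Matrix.mul_apply, Fintype.sum_prod_type]

/-! ### Squared length of a projection of a unitary, and its change under Pauli rotations -/

/-- The squared length of the vector of linear functionals `tr (X z * U)` of a matrix `U`. -/
def weight {Z Q : Type} [Fintype Z] [Fintype Q] (X : Z → Matrix Q Q ℂ) (U : Matrix Q Q ℂ) : ℝ :=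
  ∑ z, ‖trace (X z * U)‖ ^ 2

/-- The real inner product polarizing `weight`. -/
def crossWeight {Z Q : Type} [Fintype Z] [Fintype Q] (X : Z → Matrix Q Q ℂ)
    (U W : Matrix Q Q ℂ) : ℝ :=
  ∑ z, (star (trace (X z * U)) * trace (X z * W)).re

section

variable {Z Q : Type} [Fintype Z] [Fintype Q] (X : Z → Matrix Q Q ℂ)

lemma weight_nonneg (U : Matrix Q Q ℂ) : 0 ≤ weight X U :=
  Finset.sum_nonneg fun _ _ => by positivity

lemma continuous_weight : Continuous (weight X) := by
  unfold weight
  fun_prop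

lemma weight_add (c s : ℝ) (U W : Matrix Q Q ℂ) :
    weight X ((c : ℂ) • U + (s : ℂ) • W) =
      c ^ 2 * weight X U + 2 * (c * s) * crossWeight X U W + s ^ 2 * weight X W := by
  unfold weight crossWeight
  simp_rw [Finset.mul_sum]
  rw [← Finset.sum_add_distrib, ← Finset.sum_add_distrib]
  refine Finset.sum_congr rfl fun z _ => ?_
  rw [Matrix.mul_add, trace_add, Matrix.mul_smul, Matrix.mul_smul, trace_smul, trace_smul]
  generalize trace (X z * U) = a
  generalize trace (X z * W) = b
  rw [Complex.sq_norm, Complex.sq_norm, Complex.sq_norm]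
  simp [Complex.normSq_apply]
  ring

end

lemma trace_unitary_mul_mul_conjTranspose {Q : Type} [Fintype Q] [DecidableEq Q]
    (U : unitaryGroup Q ℂ) (M : Matrix Q Q ℂ) :
    trace ((U : Matrix Q Q ℂ) * M * ((U : Matrix Q Q ℂ) * M)ᴴ) = trace (M * Mᴴ) := by
  have h : (U : Matrix Q Q ℂ)ᴴ * (U : Matrix Q Q ℂ) = 1 := Unitary.coe_star_mul_self U
  rw [conjTranspose_mul, trace_mul_comm, Matrix.mul_assoc, ← Matrix.mul_assoc _ _ M, h,
    Matrix.one_mul, trace_mul_comm]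

section

variable {Z P : Type} [Fintype Z] [Fintype P] [DecidableEq P]
  {X : Z → Matrix (Qubits P) (Qubits P) ℂ} {κ : ℝ}

lemma continuous_weight_coe :
    Continuous fun U : unitaryGroup (Qubits P) ℂ => weight X (U : Matrix _ _ ℂ) :=
  (continuous_weight X).comp continuous_subtype_val

/-- Averaging over the `d²` Pauli strings replaces the weight by its Haar mean `|Z| κ / d`. -/
lemma sum_weight_skewPauli_mul
    [DecidableEq Z] (hX : ∀ z z', trace (X z * (X z')ᴴ) = if z = z' then (κ : ℂ) else 0)
    (U : unitaryGroup (Qubits P) ℂ) :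
    ∑ j, weight X (skewPauli j * (U : Matrix _ _ ℂ)) = Fintype.card (Qubits P) * (Fintype.card Z * κ) := by
  unfold weight
  rw [Finset.sum_comm]
  have h : ∀ z, ∑ j, ‖trace (X z * (skewPauli j * (U : Matrix _ _ ℂ)))‖ ^ 2 =
      Fintype.card (Qubits P) * κ := by
    intro z
    have h1 := sum_norm_trace_mul_skewPauli ((U : Matrix _ _ ℂ) * X z)
    rw [trace_unitary_mul_mul_conjTranspose, hX, if_pos rfl] at h1
    have h2 : ∀ j, trace (X z * (skewPauli j * (U : Matrix _ _ ℂ))) =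
        trace ((U : Matrix _ _ ℂ) * X z * skewPauli j) := by
      intro j
      rw [← Matrix.mul_assoc, trace_mul_comm, Matrix.mul_assoc]
    simp_rw [h2]
    exact_mod_cast h1
  simp_rw [h]
  simp
  ring

/-- Bessel's inequality bounds the first-order change of the weight by the weight itself. -/
lemma sum_crossWeight_sq_le
    [DecidableEq Z] (hX : ∀ z z', trace (X z * (X z')ᴴ) = if z = z' then (κ : ℂ) else 0)
    (U : unitaryGroup (Qubits P) ℂ) :
    ∑ j, crossWeight X U (skewPauli j * (U : Matrix _ _ ℂ)) ^ 2 ≤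
      Fintype.card (Qubits P) * (κ * weight X U) := by
  set M : Matrix (Qubits P) (Qubits P) ℂ :=
    ∑ z, star (trace (X z * (U : Matrix _ _ ℂ))) • X z with hM
  have hMM : trace (M * Mᴴ) = ((κ * weight X U : ℝ) : ℂ) := by
    rw [hM, conjTranspose_sum, Finset.sum_mul, trace_sum]
    have : ∀ z, trace ((star (trace (X z * (U : Matrix _ _ ℂ))) • X z) *
        ∑ z', (star (trace (X z' * (U : Matrix _ _ ℂ))) • X z')ᴴ) =
        ((κ * ‖trace (X z * (U : Matrix _ _ ℂ))‖ ^ 2 : ℝ) : ℂ) := by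
      intro z
      rw [Finset.mul_sum, trace_sum, Finset.sum_eq_single z]
      · rw [conjTranspose_smul, star_star, Matrix.smul_mul, Matrix.mul_smul, trace_smul,
          trace_smul, hX, if_pos rfl, Complex.ofReal_mul, Complex.ofReal_pow, ← Complex.mul_conj']
        simp only [smul_eq_mul, RCLike.star_def]
        ring
      · intro z' _ hz'
        rw [conjTranspose_smul, Matrix.smul_mul, Matrix.mul_smul, trace_smul,
          trace_smul, hX, if_neg (Ne.symm hz')]
        simp
      · simp
    simp_rw [this]
    unfold weight
    rw [Finset.mul_sum, Complex.ofReal_sum]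
  have hN := sum_norm_trace_mul_skewPauli ((U : Matrix _ _ ℂ) * M)
  rw [trace_unitary_mul_mul_conjTranspose, hMM] at hN
  have hN' : ∑ j, ‖trace ((U : Matrix _ _ ℂ) * M * skewPauli j)‖ ^ 2 =
      Fintype.card (Qubits P) * (κ * weight X U) := by exact_mod_cast hN
  rw [← hN']
  refine Finset.sum_le_sum fun j _ => ?_
  have h : crossWeight X U (skewPauli j * (U : Matrix _ _ ℂ)) =
      (trace ((U : Matrix _ _ ℂ) * M * skewPauli j)).re := by
    unfold crossWeight
    rw [← Complex.re_sum]
    congr 1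
    rw [Matrix.mul_assoc, trace_mul_comm, hM, Finset.sum_mul, Finset.sum_mul, trace_sum]
    refine Finset.sum_congr rfl fun z _ => ?_
    rw [Matrix.smul_mul, Matrix.smul_mul, trace_smul, smul_eq_mul, Matrix.mul_assoc]
  rw [h, ← sq_abs]
  exact pow_le_pow_left₀ (abs_nonneg _) (Complex.abs_re_le_norm _) 2

/-- The one-parameter group `exp (θ A) = cos θ + sin θ A` of an anti-Hermitian Pauli string `A`. -/
def pauliRotation (j : Qubits P × Qubits P) (θ : ℝ) : unitaryGroup (Qubits P) ℂ :=
  ⟨((Real.cos θ : ℝ) : ℂ) • 1 + ((Real.sin θ : ℝ) : ℂ) • skewPauli j, by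
    rw [mem_unitaryGroup_iff, star_eq_conjTranspose, conjTranspose_add, conjTranspose_smul,
      conjTranspose_smul, skewPauli_conjTranspose, conjTranspose_one]
    have h : ((Real.cos θ : ℝ) : ℂ) ^ 2 + ((Real.sin θ : ℝ) : ℂ) ^ 2 = 1 := by
      exact_mod_cast Real.cos_sq_add_sin_sq θ
    simp only [RCLike.star_def, Complex.conj_ofReal, Matrix.add_mul, Matrix.mul_add,
      Matrix.smul_mul, Matrix.mul_smul, Matrix.one_mul, Matrix.mul_one, Matrix.mul_neg,
      skewPauli_mul_self, smul_neg]
    trans ((Complex.ofReal (Real.cos θ)) ^ 2 + (Complex.ofReal (Real.sin θ)) ^ 2) •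
      (1 : Matrix (Qubits P) (Qubits P) ℂ)
    · module
    · rw [h, one_smul]⟩

lemma pauliRotation_coe_mul (j : Qubits P × Qubits P) (θ : ℝ) (U : unitaryGroup (Qubits P) ℂ) :
    ((pauliRotation j θ * U : unitaryGroup (Qubits P) ℂ) : Matrix (Qubits P) (Qubits P) ℂ) =
      ((Real.cos θ : ℝ) : ℂ) • (U : Matrix _ _ ℂ) +
        ((Real.sin θ : ℝ) : ℂ) • (skewPauli j * (U : Matrix _ _ ℂ)) := by
  change (((Real.cos θ : ℝ) : ℂ) • 1 + ((Real.sin θ : ℝ) : ℂ) • skewPauli j) * _ = _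
  rw [Matrix.add_mul, Matrix.smul_mul, Matrix.smul_mul, Matrix.one_mul]

lemma pauliRotation_inv (j : Qubits P × Qubits P) (θ : ℝ) :
    (pauliRotation j θ)⁻¹ = pauliRotation j (-θ) := by
  apply Subtype.ext
  change star (((Real.cos θ : ℝ) : ℂ) • 1 + ((Real.sin θ : ℝ) : ℂ) • skewPauli j) =
    (((Real.cos (-θ) : ℝ) : ℂ) • 1 + ((Real.sin (-θ) : ℝ) : ℂ) • skewPauli j)
  rw [star_eq_conjTranspose, conjTranspose_add, conjTranspose_smul,
      conjTranspose_smul, skewPauli_conjTranspose, conjTranspose_one, Real.cos_neg, Real.sin_neg]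
  simp only [RCLike.star_def, Complex.conj_ofReal, Complex.ofReal_neg, smul_neg, neg_smul]

lemma weight_pauliRotation_mul (j : Qubits P × Qubits P) (θ : ℝ)
    (U : unitaryGroup (Qubits P) ℂ) :
    weight X ((pauliRotation j θ * U : unitaryGroup (Qubits P) ℂ) : Matrix _ _ ℂ) =
      Real.cos θ ^ 2 * weight X U +
        2 * (Real.cos θ * Real.sin θ) * crossWeight X U (skewPauli j * (U : Matrix _ _ ℂ)) +
        Real.sin θ ^ 2 * weight X (skewPauli j * (U : Matrix _ _ ℂ)) := by
  rw [pauliRotation_coe_mul, weight_add]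

end

/-! ### Moments of the weight under Haar measure -/

lemma sub_mul_pow_sub_pow_le {a b : ℝ} (ha : 0 ≤ a) (hb : 0 ≤ b) (k : ℕ) :
    (a - b) * (a ^ k - b ^ k) ≤ k * ((a - b) ^ 2 * (a ^ (k - 1) + b ^ (k - 1))) := by
  have h1 := abs_pow_sub_pow_le a b k
  rw [abs_of_nonneg ha, abs_of_nonneg hb] at h1
  have h2 : max a b ^ (k - 1) ≤ a ^ (k - 1) + b ^ (k - 1) := by
    rcases max_cases a b with ⟨h, _⟩ | ⟨h, _⟩ <;> rw [h]
    · linarith [pow_nonneg hb (k - 1)]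
    · linarith [pow_nonneg ha (k - 1)]
  calc (a - b) * (a ^ k - b ^ k) ≤ |a - b| * |a ^ k - b ^ k| := by
        rw [← abs_mul]
        exact le_abs_self _
    _ ≤ |a - b| * (|a - b| * k * (a ^ (k - 1) + b ^ (k - 1))) := by
        gcongr
        exact h1.trans (by gcongr)
    _ = k * ((a - b) ^ 2 * (a ^ (k - 1) + b ^ (k - 1))) := by
        rw [← sq_abs (a - b)]
        ring

/-- The exchangeable pair inequality for the translate of a Haar-distributed element by `V`. -/
lemma integral_exchange_le {G : Type} [Group G] [TopologicalSpace G] [IsTopologicalGroup G]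
    [CompactSpace G] [MeasurableSpace G] [BorelSpace G] (μ : Measure G) [IsProbabilityMeasure μ]
    [μ.IsMulLeftInvariant] {f : G → ℝ} (hf : Continuous f) (h0 : ∀ U, 0 ≤ f U) (V : G) (k : ℕ) :
    ∫ U, (2 * f U - f (V * U) - f (V⁻¹ * U)) * f U ^ k ∂μ ≤
      ∫ U, k * (((f U - f (V * U)) ^ 2 + (f U - f (V⁻¹ * U)) ^ 2) * f U ^ (k - 1)) ∂μ := by
  have hint : ∀ {g : G → ℝ}, Continuous g → Integrable g μ := fun hg =>
    hg.integrable_of_hasCompactSupport (HasCompactSupport.of_compactSpace _)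
  have hV : Continuous fun U => f (V * U) := hf.comp (continuous_const.mul continuous_id)
  have hV' : Continuous fun U => f (V⁻¹ * U) := hf.comp (continuous_const.mul continuous_id)
  have e1 : ∫ U, (f U - f (V⁻¹ * U)) * f U ^ k ∂μ = ∫ U, (f (V * U) - f U) * f (V * U) ^ k ∂μ := by
    rw [← integral_mul_left_eq_self (fun U => (f U - f (V⁻¹ * U)) * f U ^ k) V]
    simp
  have e2 : ∫ U, k * ((f U - f (V⁻¹ * U)) ^ 2 * f U ^ (k - 1)) ∂μ =
      ∫ U, k * ((f U - f (V * U)) ^ 2 * f (V * U) ^ (k - 1)) ∂μ := by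
    rw [← integral_mul_left_eq_self
      (fun U => k * ((f U - f (V⁻¹ * U)) ^ 2 * f U ^ (k - 1))) V]
    refine integral_congr_ae (Filter.Eventually.of_forall fun U => ?_)
    simp only [inv_mul_cancel_left]
    ring
  calc ∫ U, (2 * f U - f (V * U) - f (V⁻¹ * U)) * f U ^ k ∂μ
      = ∫ U, ((f U - f (V * U)) * f U ^ k + (f U - f (V⁻¹ * U)) * f U ^ k) ∂μ :=
        integral_congr_ae (Filter.Eventually.of_forall fun U => by ring)
    _ = ∫ U, (f U - f (V * U)) * f U ^ k ∂μ + ∫ U, (f (V * U) - f U) * f (V * U) ^ k ∂μ := by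
        rw [integral_add (hint (by fun_prop)) (hint (by fun_prop)), e1]
    _ = ∫ U, (f U - f (V * U)) * (f U ^ k - f (V * U) ^ k) ∂μ := by
        rw [← integral_add (hint (by fun_prop)) (hint (by fun_prop))]
        exact integral_congr_ae (Filter.Eventually.of_forall fun U => by ring)
    _ ≤ ∫ U, (k * ((f U - f (V * U)) ^ 2 * f U ^ (k - 1)) +
          k * ((f U - f (V * U)) ^ 2 * f (V * U) ^ (k - 1))) ∂μ := by
        refine integral_mono (hint (by fun_prop)) (hint (by fun_prop)) fun U => ?_
        refine (sub_mul_pow_sub_pow_le (h0 _) (h0 _) k).trans_eq ?_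
        ring
    _ = _ := by
        rw [integral_add (hint (by fun_prop)) (hint (by fun_prop)), ← e2,
          ← integral_add (hint (by fun_prop)) (hint (by fun_prop))]
        exact integral_congr_ae (Filter.Eventually.of_forall fun U => by ring)

lemma integral_sum_exchange_le {G ι : Type} [Fintype ι] [Group G] [TopologicalSpace G]
    [IsTopologicalGroup G] [CompactSpace G] [MeasurableSpace G] [BorelSpace G] (μ : Measure G)
    [IsProbabilityMeasure μ] [μ.IsMulLeftInvariant] {f : G → ℝ} (hf : Continuous f)
    (h0 : ∀ U, 0 ≤ f U) (V : ι → G) (k : ℕ) :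
    ∫ U, (∑ j, (2 * f U - f (V j * U) - f ((V j)⁻¹ * U))) * f U ^ k ∂μ ≤
      ∫ U, k * ((∑ j, ((f U - f (V j * U)) ^ 2 + (f U - f ((V j)⁻¹ * U)) ^ 2)) *
        f U ^ (k - 1)) ∂μ := by
  have hint : ∀ {g : G → ℝ}, Continuous g → Integrable g μ := fun hg =>
    hg.integrable_of_hasCompactSupport (HasCompactSupport.of_compactSpace _)
  have hV : ∀ W : G, Continuous fun U => f (W * U) := fun W =>
    hf.comp (continuous_const.mul continuous_id)
  have hV1 : ∀ j, Continuous fun U => f (V j * U) := fun j => hV _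
  have hV2 : ∀ j, Continuous fun U => f ((V j)⁻¹ * U) := fun j => hV _
  have e1 : ∀ U, (∑ j, (2 * f U - f (V j * U) - f ((V j)⁻¹ * U))) * f U ^ k =
      ∑ j, (2 * f U - f (V j * U) - f ((V j)⁻¹ * U)) * f U ^ k := fun U => Finset.sum_mul _ _ _
  have e2 : ∀ U, k * ((∑ j, ((f U - f (V j * U)) ^ 2 + (f U - f ((V j)⁻¹ * U)) ^ 2)) *
        f U ^ (k - 1)) = ∑ j, k * (((f U - f (V j * U)) ^ 2 + (f U - f ((V j)⁻¹ * U)) ^ 2) *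
        f U ^ (k - 1)) := fun U => by rw [Finset.sum_mul, Finset.mul_sum]
  simp_rw [e1, e2]
  rw [integral_finsetSum _ fun j _ => hint (by fun_prop),
    integral_finsetSum _ fun j _ => hint (by fun_prop)]
  exact Finset.sum_le_sum fun j _ => integral_exchange_le μ hf h0 (V j) k

/-- If averaging over the translates by `V j` and their inverses acts on `f` as an affine map, and
the squared increments are bounded by an affine function of `f`, then the moments of `f` satisfy a
recursion. -/
lemma moment_recursion {G ι : Type} [Fintype ι] [Group G] [TopologicalSpace G]
    [IsTopologicalGroup G] [CompactSpace G] [MeasurableSpace G] [BorelSpace G] (μ : Measure G)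
    [IsProbabilityMeasure μ] [μ.IsMulLeftInvariant] {f : G → ℝ} (hf : Continuous f)
    (h0 : ∀ U, 0 ≤ f U) (V : ι → G) {a α β σ τ : ℝ} (ha : 0 < a)
    (h1 : ∀ U, ∑ j, (2 * f U - f (V j * U) - f ((V j)⁻¹ * U)) = a * (α * f U - β))
    (h2 : ∀ U, ∑ j, ((f U - f (V j * U)) ^ 2 + (f U - f ((V j)⁻¹ * U)) ^ 2) ≤
      a * (σ + τ * f U)) (k : ℕ) :
    α * ∫ U, f U ^ (k + 1) ∂μ - β * ∫ U, f U ^ k ∂μ ≤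
      k * (σ * ∫ U, f U ^ (k - 1) ∂μ + τ * ∫ U, f U ^ k ∂μ) := by
  have hint : ∀ {g : G → ℝ}, Continuous g → Integrable g μ := fun hg =>
    hg.integrable_of_hasCompactSupport (HasCompactSupport.of_compactSpace _)
  have hV : ∀ W : G, Continuous fun U => f (W * U) := fun W =>
    hf.comp (continuous_const.mul continuous_id)
  have hV1 : ∀ j, Continuous fun U => f (V j * U) := fun j => hV _
  have hV2 : ∀ j, Continuous fun U => f ((V j)⁻¹ * U) := fun j => hV _
  have h3 := integral_sum_exchange_le μ hf h0 V k
  simp only [h1] at h3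
  refine le_of_mul_le_mul_left ?_ ha
  calc a * (α * ∫ U, f U ^ (k + 1) ∂μ - β * ∫ U, f U ^ k ∂μ)
      = ∫ U, (a * α * f U ^ (k + 1) - a * β * f U ^ k) ∂μ := by
        rw [integral_sub (hint (by fun_prop)) (hint (by fun_prop)), integral_const_mul,
          integral_const_mul]
        ring
    _ = _ := integral_congr_ae (Filter.Eventually.of_forall fun U => by ring)
    _ ≤ _ := h3
    _ ≤ ∫ U, (a * (k * σ) * f U ^ (k - 1) + a * (k * τ) * f U ^ k) ∂μ := by
        refine integral_mono (hint (by fun_prop)) (hint (by fun_prop)) fun U => ?_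
        have h4 : (k : ℝ) * f U ^ k = k * (f U * f U ^ (k - 1)) := by
          cases k with
          | zero => simp
          | succ k => rw [Nat.add_sub_cancel, pow_succ']
        refine (mul_le_mul_of_nonneg_left (mul_le_mul_of_nonneg_right (h2 U)
          (pow_nonneg (h0 U) _)) (Nat.cast_nonneg k)).trans_eq ?_
        linear_combination (-(a * τ)) * h4
    _ = _ := by
        rw [integral_add (hint (by fun_prop)) (hint (by fun_prop)), integral_const_mul,
          integral_const_mul]
        ring

section

variable {Z P : Type} [Fintype Z] [DecidableEq Z] [Fintype P] [DecidableEq P]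
  {X : Z → Matrix (Qubits P) (Qubits P) ℂ} {κ : ℝ}

/-- The weight minus its Haar mean is an eigenfunction of averaging over Pauli rotations. -/
lemma sum_second_difference_weight
    (hX : ∀ z z', trace (X z * (X z')ᴴ) = if z = z' then (κ : ℂ) else 0) (θ : ℝ)
    (U : unitaryGroup (Qubits P) ℂ) :
    ∑ j, (2 * weight X U -
        weight X ((pauliRotation j θ * U : unitaryGroup (Qubits P) ℂ) : Matrix _ _ ℂ) -
        weight X (((pauliRotation j θ)⁻¹ * U : unitaryGroup (Qubits P) ℂ) : Matrix _ _ ℂ)) =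
      2 * Real.sin θ ^ 2 * ((Fintype.card (Qubits P) : ℝ) ^ 2 * weight X U -
        Fintype.card (Qubits P) * (Fintype.card Z * κ)) := by
  rw [← sum_weight_skewPauli_mul hX U]
  have hc : (∑ _j : Qubits P × Qubits P, weight X U) =
      (Fintype.card (Qubits P) : ℝ) ^ 2 * weight X U := by
    rw [Finset.sum_const, Finset.card_univ, Fintype.card_prod, nsmul_eq_mul]
    push_cast
    ring
  rw [← hc, ← Finset.sum_sub_distrib, Finset.mul_sum]
  refine Finset.sum_congr rfl fun j _ => ?_
  rw [pauliRotation_inv, weight_pauliRotation_mul, weight_pauliRotation_mul, Real.cos_neg,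
    Real.sin_neg, Real.cos_sq']
  ring

lemma sum_sq_difference_weight_le
    (hX : ∀ z z', trace (X z * (X z')ᴴ) = if z = z' then (κ : ℂ) else 0) (θ : ℝ)
    (U : unitaryGroup (Qubits P) ℂ) {B : ℝ}
    (hB : ∀ W : unitaryGroup (Qubits P) ℂ, weight X W ≤ B) :
    ∑ j, ((weight X U -
        weight X ((pauliRotation j θ * U : unitaryGroup (Qubits P) ℂ) : Matrix _ _ ℂ)) ^ 2 +
        (weight X U - weight X
          (((pauliRotation j θ)⁻¹ * U : unitaryGroup (Qubits P) ℂ) : Matrix _ _ ℂ)) ^ 2) ≤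
      2 * Real.sin θ ^ 2 * (Real.sin θ ^ 2 * (Fintype.card (Qubits P) : ℝ) ^ 2 * B ^ 2 +
        4 * (Fintype.card (Qubits P) * (κ * weight X U))) := by
  have hc : (Fintype.card (Qubits P) : ℝ) ^ 2 * B ^ 2 =
      (∑ _j : Qubits P × Qubits P, B ^ 2) := by
    rw [Finset.sum_const, Finset.card_univ, Fintype.card_prod, nsmul_eq_mul]
    push_cast
    ring
  have h1 : ∀ j : Qubits P × Qubits P, (weight X U -
        weight X ((pauliRotation j θ * U : unitaryGroup (Qubits P) ℂ) : Matrix _ _ ℂ)) ^ 2 +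
        (weight X U - weight X
          (((pauliRotation j θ)⁻¹ * U : unitaryGroup (Qubits P) ℂ) : Matrix _ _ ℂ)) ^ 2 ≤
      2 * Real.sin θ ^ 2 * (Real.sin θ ^ 2 * B ^ 2 +
        4 * crossWeight X U (skewPauli j * (U : Matrix _ _ ℂ)) ^ 2) := by
    intro j
    rw [pauliRotation_inv, weight_pauliRotation_mul, weight_pauliRotation_mul, Real.cos_neg,
      Real.sin_neg]
    have hA : (skewPauli j : Matrix _ _ ℂ) * (U : Matrix _ _ ℂ) =
        ((pauliRotation j (Real.pi / 2) * U : unitaryGroup (Qubits P) ℂ) : Matrix _ _ ℂ) := by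
      rw [pauliRotation_coe_mul]
      simp
    have hw1 : weight X (skewPauli j * (U : Matrix _ _ ℂ)) ≤ B := by
      rw [hA]
      exact hB _
    have hw0 := weight_nonneg X (skewPauli j * (U : Matrix _ _ ℂ))
    have hU1 := hB U
    have hU0 := weight_nonneg X (U : Matrix _ _ ℂ)
    generalize weight X (skewPauli j * (U : Matrix _ _ ℂ)) = w at *
    generalize weight X (U : Matrix _ _ ℂ) = u at *
    generalize crossWeight X U (skewPauli j * (U : Matrix _ _ ℂ)) = r
    have hs0 : 0 ≤ Real.sin θ ^ 2 := sq_nonneg _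
    have hcs := Real.cos_sq' θ
    have e : (u - (Real.cos θ ^ 2 * u + 2 * (Real.cos θ * Real.sin θ) * r + Real.sin θ ^ 2 * w)) ^ 2
        + (u - (Real.cos θ ^ 2 * u + 2 * (Real.cos θ * -Real.sin θ) * r +
          (-Real.sin θ) ^ 2 * w)) ^ 2 = 2 * Real.sin θ ^ 2 * (Real.sin θ ^ 2 * (u - w) ^ 2 +
          4 * (1 - Real.sin θ ^ 2) * r ^ 2) := by
      rw [hcs]
      linear_combination (8 * Real.sin θ ^ 2 * r ^ 2) * hcs
    rw [e]
    have h2 : (u - w) ^ 2 ≤ B ^ 2 := by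
      rw [← sq_abs]
      exact pow_le_pow_left₀ (abs_nonneg _) (abs_le.2 ⟨by linarith, by linarith⟩) 2
    have h3 : (1 - Real.sin θ ^ 2) * r ^ 2 ≤ r ^ 2 := by nlinarith [sq_nonneg r]
    have h4 : Real.sin θ ^ 2 * (u - w) ^ 2 ≤ Real.sin θ ^ 2 * B ^ 2 :=
      mul_le_mul_of_nonneg_left h2 hs0
    refine mul_le_mul_of_nonneg_left ?_ (by linarith)
    linarith
  refine (Finset.sum_le_sum fun j _ => h1 j).trans ?_
  rw [← Finset.mul_sum, Finset.sum_add_distrib, ← Finset.mul_sum, ← Finset.mul_sum, ← hc]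
  refine mul_le_mul_of_nonneg_left ?_ (by positivity)
  linarith [sum_crossWeight_sq_le hX U]

/-- Recursion for the moments of the weight of a Haar-distributed unitary: the weight is an
eigenfunction, up to a constant, of averaging over Pauli rotations by a small angle `θ`, and the
exchangeable pair inequality is used in the limit `θ → 0`. -/
lemma integral_weight_pow_succ_le
    (hX : ∀ z z', trace (X z * (X z')ᴴ) = if z = z' then (κ : ℂ) else 0) (k : ℕ) :
    ∫ U, weight X (U : Matrix _ _ ℂ) ^ (k + 1) ∂haarUnitary (Qubits P) ≤
      ((Fintype.card Z + 4 * k) * κ / Fintype.card (Qubits P)) *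
        ∫ U, weight X (U : Matrix _ _ ℂ) ^ k ∂haarUnitary (Qubits P) := by
  have hinv : (haarUnitary (Qubits P)).IsMulLeftInvariant := by
    rw [haarUnitary]
    infer_instance
  have hf : Continuous fun U : unitaryGroup (Qubits P) ℂ => weight X (U : Matrix _ _ ℂ) :=
    continuous_weight_coe
  obtain ⟨B, hB⟩ : ∃ B, ∀ W : unitaryGroup (Qubits P) ℂ, weight X W ≤ B := by
    obtain ⟨B, hB⟩ := (isCompact_range hf).bddAbove
    exact ⟨B, fun W => hB ⟨W, rfl⟩⟩
  have hd0 : 0 < (Fintype.card (Qubits P) : ℝ) := by exact_mod_cast Fintype.card_pos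
  have key : ∀ θ ∈ Set.Ioo 0 Real.pi, _ := fun θ hθ =>
    moment_recursion (haarUnitary (Qubits P)) hf (fun U => weight_nonneg X _)
      (fun j => pauliRotation j θ)
      (mul_pos two_pos (pow_pos (Real.sin_pos_of_mem_Ioo hθ) 2))
      (fun U => sum_second_difference_weight hX θ U)
      (fun U => (sum_sq_difference_weight_le hX θ U hB).trans_eq
        (show _ = 2 * Real.sin θ ^ 2 * (Real.sin θ ^ 2 * (Fintype.card (Qubits P) : ℝ) ^ 2 * B ^ 2 +
          (4 * (Fintype.card (Qubits P) * κ)) * weight X U) by ring)) k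
  generalize ∫ U, weight X (U : Matrix _ _ ℂ) ^ (k + 1) ∂haarUnitary (Qubits P) = J₁ at *
  generalize ∫ U, weight X (U : Matrix _ _ ℂ) ^ k ∂haarUnitary (Qubits P) = J at *
  generalize ∫ U, weight X (U : Matrix _ _ ℂ) ^ (k - 1) ∂haarUnitary (Qubits P) = J' at *
  generalize (Fintype.card (Qubits P) : ℝ) = d at *
  generalize (Fintype.card Z : ℝ) = L at *
  have hlim : d ^ 2 * J₁ - d * (L * κ) * J ≤ k * (4 * (d * κ) * J) := by
    have hcont : Continuous (fun θ : ℝ =>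
      k * (Real.sin θ ^ 2 * d ^ 2 * B ^ 2 * J' + 4 * (d * κ) * J)) := by fun_prop
    have h4 := hcont.tendsto 0
    simp only [Real.sin_zero, ne_eq, OfNat.ofNat_ne_zero, not_false_eq_true, zero_pow, zero_mul,
      zero_add] at h4
    refine ge_of_tendsto (h4.mono_left (nhdsWithin_le_nhds (s := Set.Ioi 0))) ?_
    filter_upwards [Ioo_mem_nhdsGT Real.pi_pos] with θ hθ using key θ hθ
  have h5 : d ^ 2 * J₁ ≤ d ^ 2 * ((L + 4 * k) * κ / d * J) := by
    have : d ^ 2 * ((L + 4 * k) * κ / d * J) = d * (L * κ) * J + k * (4 * (d * κ) * J) := by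
      field_simp
    linarith
  exact le_of_mul_le_mul_left h5 (by positivity)

end

/-! ### Tail bound for the weight -/

section

variable {Z P : Type} [Fintype Z] [DecidableEq Z] [Fintype P] [DecidableEq P]
  {X : Z → Matrix (Qubits P) (Qubits P) ℂ} {κ κ' : ℝ}

lemma integral_weight_pow_le
    (hX : ∀ z z', trace (X z * (X z')ᴴ) = if z = z' then (κ' : ℂ) else 0) (hκ : κ' ≤ κ)
    (hκ0 : 0 ≤ κ) {k i : ℕ} (hi : i ≤ k) :
    ∫ U, weight X (U : Matrix _ _ ℂ) ^ i ∂haarUnitary (Qubits P) ≤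
      ((Fintype.card Z + 4 * k) * κ / Fintype.card (Qubits P)) ^ i := by
  induction i with
  | zero => simp
  | succ i ih =>
    refine (integral_weight_pow_succ_le hX i).trans ?_
    rw [pow_succ']
    have h0 : 0 ≤ ∫ U, weight X (U : Matrix _ _ ℂ) ^ i ∂haarUnitary (Qubits P) :=
      integral_nonneg fun U => pow_nonneg (weight_nonneg X _) _
    have hik : (i : ℝ) ≤ k := by exact_mod_cast (Nat.le_succ i).trans hi
    refine mul_le_mul ?_ (ih ((Nat.le_succ i).trans hi)) h0 (by positivity)
    refine div_le_div_of_nonneg_right ?_ (Nat.cast_nonneg _)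
    exact (mul_le_mul_of_nonneg_left hκ (by positivity)).trans
      (mul_le_mul_of_nonneg_right (by linarith) hκ0)

/-- Markov's inequality for the `k`-th moment of the weight. -/
lemma haar_weight_ge_le [Nonempty Z]
    (hX : ∀ z z', trace (X z * (X z')ᴴ) = if z = z' then (κ' : ℂ) else 0) (hκ : κ' ≤ κ)
    (hκ0 : 0 < κ) {η : ℝ} (hη : 0 < η) (k : ℕ) :
    haarUnitary (Qubits P) {U | (1 + η) * (Fintype.card Z * κ / Fintype.card (Qubits P)) ≤
        weight X (U : Matrix _ _ ℂ)} ≤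
      ENNReal.ofReal (((1 + 4 * k / Fintype.card Z) / (1 + η)) ^ k) := by
  have hL : 0 < (Fintype.card Z : ℝ) := by exact_mod_cast Fintype.card_pos
  have hd : 0 < (Fintype.card (Qubits P) : ℝ) := by exact_mod_cast Fintype.card_pos
  set a := (1 + η) * (Fintype.card Z * κ / Fintype.card (Qubits P)) with ha
  have ha0 : 0 < a := by positivity
  have hf : Continuous fun U : unitaryGroup (Qubits P) ℂ => weight X (U : Matrix _ _ ℂ) :=
    continuous_weight_coe
  have h1 := mul_meas_ge_le_integral_of_nonneg (μ := haarUnitary (Qubits P))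
    (f := fun U => weight X (U : Matrix _ _ ℂ) ^ k)
    (Filter.Eventually.of_forall fun U => pow_nonneg (weight_nonneg X _) _)
    ((hf.pow k).integrable_of_hasCompactSupport (HasCompactSupport.of_compactSpace _)) (a ^ k)
  have h2 := h1.trans (integral_weight_pow_le hX hκ hκ0.le le_rfl)
  have h3 : {U : unitaryGroup (Qubits P) ℂ | a ≤ weight X (U : Matrix _ _ ℂ)} ⊆
      {U | a ^ k ≤ weight X (U : Matrix _ _ ℂ) ^ k} := fun U hU =>
    pow_le_pow_left₀ ha0.le hU k
  refine (measure_mono h3).trans ?_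
  rw [← ofReal_measureReal]
  refine ENNReal.ofReal_le_ofReal ?_
  rw [mul_comm, ← le_div_iff₀ (by positivity), ← div_pow] at h2
  refine h2.trans_eq ?_
  congr 1
  rw [ha]
  field_simp

end

/-! ### Nets in the unit ball -/

/-- A separated set in the unit ball of a real normed space of dimension `n` has at most
`(1 + 2 / τ) ^ n` elements, by comparison of volumes. -/
lemma card_le_of_separated_unitBall {E : Type} [NormedAddCommGroup E] [NormedSpace ℝ E]
    [FiniteDimensional ℝ E] {τ : ℝ} (hτ : 0 < τ) (s : Finset E) (hs : ∀ c ∈ s, ‖c‖ ≤ 1)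
    (h : ∀ c ∈ s, ∀ d ∈ s, c ≠ d → τ ≤ ‖c - d‖) :
    (s.card : ℝ) ≤ (1 + 2 / τ) ^ Module.finrank ℝ E := by
  borelize E
  let μ : Measure E := Measure.addHaar
  have hδ : 0 < τ / 2 := by positivity
  have hρ : 0 < 1 + τ / 2 := by positivity
  have hdisj : Set.Pairwise (s : Set E) (Function.onFun Disjoint fun c => Metric.ball c (τ / 2)) := by
    intro c hc d hd hcd
    apply Metric.ball_disjoint_ball
    rw [dist_eq_norm, add_halves]
    exact h c hc d hd hcd
  have hsub : (⋃ c ∈ s, Metric.ball c (τ / 2)) ⊆ Metric.ball (0 : E) (1 + τ / 2) := by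
    refine Set.iUnion₂_subset fun x hx => Metric.ball_subset_ball' ?_
    rw [dist_zero_right]
    linarith [hs x hx]
  have hI : (s.card : ENNReal) * ENNReal.ofReal ((τ / 2) ^ Module.finrank ℝ E) *
      μ (Metric.ball 0 1) ≤
      ENNReal.ofReal ((1 + τ / 2) ^ Module.finrank ℝ E) * μ (Metric.ball 0 1) := by
    have h1 := measure_mono (μ := μ) hsub
    rw [measure_biUnion_finset hdisj fun c _ => measurableSet_ball,
      μ.addHaar_ball_of_pos _ hρ] at h1
    simp only [μ.addHaar_ball_of_pos _ hδ] at h1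
    simpa only [Finset.sum_const, nsmul_eq_mul, mul_assoc] using h1
  have hJ := (ENNReal.mul_le_mul_iff_left (Metric.measure_ball_pos _ _ zero_lt_one).ne'
    measure_ball_lt_top.ne).1 hI
  have hK := ENNReal.toReal_le_of_le_ofReal (pow_nonneg hρ.le _) hJ
  rw [ENNReal.toReal_mul, ENNReal.toReal_natCast, ENNReal.toReal_ofReal (by positivity),
    ← le_div_iff₀ (by positivity), ← div_pow] at hK
  refine hK.trans_eq ?_
  congr 1
  field_simp
  ring

lemma exists_net_unitBall (E : Type) [NormedAddCommGroup E] [NormedSpace ℝ E]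
    [FiniteDimensional ℝ E] {τ : ℝ} (hτ : 0 < τ) :
    ∃ s : Finset E, (s.card : ℝ) ≤ (1 + 2 / τ) ^ Module.finrank ℝ E ∧ (∀ c ∈ s, ‖c‖ ≤ 1) ∧
      ∀ x, ‖x‖ ≤ 1 → ∃ c ∈ s, ‖x - c‖ ≤ τ := by
  classical
  let S : Set ℕ := {n | ∃ s : Finset E, s.card = n ∧ (∀ c ∈ s, ‖c‖ ≤ 1) ∧
    ∀ c ∈ s, ∀ d ∈ s, c ≠ d → τ ≤ ‖c - d‖}
  have hne : S.Nonempty := ⟨0, ∅, by simp⟩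
  have hbdd : BddAbove S := by
    refine ⟨⌊(1 + 2 / τ) ^ Module.finrank ℝ E⌋₊, ?_⟩
    rintro _ ⟨s, rfl, h1, h2⟩
    exact Nat.le_floor (card_le_of_separated_unitBall hτ s h1 h2)
  obtain ⟨s, hcard, h1, h2⟩ := Nat.sSup_mem hne hbdd
  refine ⟨s, card_le_of_separated_unitBall hτ s h1 h2, h1, fun x hx => ?_⟩
  by_contra! hcon
  have hxs : x ∉ s := fun hxs => by
    have := hcon x hxs
    simp only [sub_self, norm_zero] at this
    linarith
  have hmem : (insert x s).card ∈ S := by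
    refine ⟨insert x s, rfl, ?_, ?_⟩
    · intro c hc
      rcases Finset.mem_insert.1 hc with rfl | hc
      exacts [hx, h1 c hc]
    · intro c hc d hd hcd
      rcases Finset.mem_insert.1 hc with hcx | hc' <;>
        rcases Finset.mem_insert.1 hd with hdx | hd'
      · exact absurd (hcx.trans hdx.symm) hcd
      · rw [hcx]
        exact (hcon d hd').le
      · rw [hdx, norm_sub_rev]
        exact (hcon c hc').le
      · exact h2 c hc' d hd' hcd
  have := le_csSup hbdd hmem
  rw [Finset.card_insert_of_notMem hxs, hcard] at this
  omega

lemma opNorm_le_of_net {E F : Type} [NormedAddCommGroup E] [NormedSpace ℂ E]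
    [NormedAddCommGroup F] [NormedSpace ℂ F] (W : E →L[ℂ] F) {s : Finset E} {τ t : ℝ}
    (hτ : τ < 1) (ht : 0 ≤ t) (hs : ∀ x, ‖x‖ ≤ 1 → ∃ c ∈ s, ‖x - c‖ ≤ τ)
    (h : ∀ c ∈ s, ‖W c‖ ≤ t) : ‖W‖ ≤ t / (1 - τ) := by
  have hτ0 : 0 ≤ τ := by
    obtain ⟨c, _, hc⟩ := hs 0 (by simp)
    exact (norm_nonneg _).trans hc
  have h1 : ‖W‖ ≤ t + τ * ‖W‖ := by
    refine W.opNorm_le_of_unit_norm (by positivity) fun x hx => ?_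
    obtain ⟨c, hc, hxc⟩ := hs x hx.le
    calc ‖W x‖ = ‖W c + W (x - c)‖ := by rw [← map_add, add_sub_cancel]
      _ ≤ ‖W c‖ + ‖W (x - c)‖ := norm_add_le _ _
      _ ≤ t + ‖W‖ * τ := add_le_add (h c hc) (W.le_opNorm_of_le hxc)
      _ = _ := by ring
  rw [le_div_iff₀ (by linarith)]
  linarith

/-! ### Uniform bound on the amplitudes of a random code -/

/-- The amplitude of a code: the vectors `v (i, m)` are sent by `U` to the register `Q`, which is
split into `X` and `Z`. Rows are indexed by a label `i` together with `X`, columns by `Z` together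
with a label `m`. -/
def codeAmplitude {ι M X Z Q : Type} [Fintype Q] (e : X × Z ≃ Q) (v : ι × M → Q → ℂ)
    (U : Matrix Q Q ℂ) : Matrix (ι × X) (Z × M) ℂ :=
  fun p q => ∑ y, U (e (p.2, q.1)) y * v (p.1, q.2) y

section

variable {ι M X Z P : Type} [Fintype ι] [Fintype M] [Fintype X] [Fintype Z] [Fintype P]
  [DecidableEq P] [DecidableEq M] [DecidableEq Z] [DecidableEq ι]
  (e : X × Z ≃ Qubits P) (v : ι × M → Qubits P → ℂ)

/-- The matrices `X (z, m)` with `tr (X (z, m) * U) = ∑ p, ξ p * codeAmplitude e v U p (z, m)`. -/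
def testMatrix (ξ : ι × X → ℂ) (q : Z × M) : Matrix (Qubits P) (Qubits P) ℂ :=
  fun y t => if (e.symm t).2 = q.1 then ∑ i, v (i, q.2) y * ξ (i, (e.symm t).1) else 0

omit [Fintype M] [DecidableEq M] [DecidableEq ι] in
lemma trace_testMatrix_mul (ξ : ι × X → ℂ) (q : Z × M) (U : Matrix (Qubits P) (Qubits P) ℂ) :
    trace (testMatrix e v ξ q * U) = ∑ p, ξ p * codeAmplitude e v U p q := by
  simp only [trace, Matrix.diag, Matrix.mul_apply]
  unfold testMatrix codeAmplitude
  have h : ∀ y, (∑ t, (if (e.symm t).2 = q.1 then ∑ i, v (i, q.2) y * ξ (i, (e.symm t).1)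
      else 0) * U t y) = ∑ p : ι × X, ξ p * (U (e (p.2, q.1)) y * v (p.1, q.2) y) := by
    intro y
    rw [← e.sum_comp, Fintype.sum_prod_type, Fintype.sum_prod_type_right]
    refine Finset.sum_congr rfl fun x _ => ?_
    simp only [Equiv.symm_apply_apply]
    rw [Finset.sum_eq_single q.1]
    · rw [if_pos rfl, Finset.sum_mul]
      exact Finset.sum_congr rfl fun i _ => by ring
    · intro z _ hz
      rw [if_neg hz, zero_mul]
    · simp
  simp_rw [h, Finset.mul_sum]
  rw [Finset.sum_comm]

omit [Fintype M] in
lemma trace_testMatrix_mul_conjTranspose {κ : ℝ}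
    (hv : ∀ p p', ∑ y, v p y * star (v p' y) = if p = p' then (κ : ℂ) else 0)
    (ξ : ι × X → ℂ) (q q' : Z × M) :
    trace (testMatrix e v ξ q * (testMatrix e v ξ q')ᴴ) =
      if q = q' then ((κ * ∑ p, ‖ξ p‖ ^ 2 : ℝ) : ℂ) else 0 := by
  have h1 : trace (testMatrix e v ξ q * (testMatrix e v ξ q')ᴴ) =
      ∑ t, if (e.symm t).2 = q.1 ∧ (e.symm t).2 = q'.1 then
        ∑ i, ∑ i', ξ (i, (e.symm t).1) * star (ξ (i', (e.symm t).1)) *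
          (∑ y, v (i, q.2) y * star (v (i', q'.2) y)) else 0 := by
    simp only [trace, Matrix.diag, Matrix.mul_apply, conjTranspose_apply]
    rw [Finset.sum_comm]
    refine Finset.sum_congr rfl fun t _ => ?_
    unfold testMatrix
    by_cases h : (e.symm t).2 = q.1
    · by_cases h' : (e.symm t).2 = q'.1
      · rw [if_pos (⟨h, h'⟩ : _ ∧ _)]
        simp only [if_pos h, if_pos h', star_sum]
        simp_rw [Finset.sum_mul_sum]
        rw [Finset.sum_comm]
        refine Finset.sum_congr rfl fun i _ => ?_
        rw [Finset.sum_comm]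
        refine Finset.sum_congr rfl fun i' _ => ?_
        rw [Finset.mul_sum]
        refine Finset.sum_congr rfl fun y _ => ?_
        rw [star_mul']
        ring
      · simp [h']
    · simp [h]
  rw [h1]
  split_ifs with hq
  · subst hq
    rw [← e.sum_comp, Fintype.sum_prod_type]
    simp only [Equiv.symm_apply_apply, and_self, hv, Prod.mk.injEq, and_true]
    rw [Fintype.sum_prod_type_right, Finset.mul_sum, Complex.ofReal_sum]
    refine Finset.sum_congr rfl fun x _ => ?_
    rw [Finset.sum_ite_eq' Finset.univ q.1, if_pos (Finset.mem_univ _), Finset.mul_sum,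
      Complex.ofReal_sum]
    refine Finset.sum_congr rfl fun i _ => ?_
    rw [Finset.sum_eq_single i]
    · rw [if_pos rfl, Complex.ofReal_mul, Complex.ofReal_pow, ← Complex.mul_conj']
      simp only [RCLike.star_def]
      ring
    · intro i' _ hi'
      rw [if_neg (Ne.symm hi'), mul_zero]
    · simp
  · refine Finset.sum_eq_zero fun t _ => ?_
    split_ifs with ht
    · have h2 : q.2 ≠ q'.2 := fun h => hq (Prod.ext (ht.1.symm.trans ht.2) h)
      refine Finset.sum_eq_zero fun i _ => Finset.sum_eq_zero fun i' _ => ?_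
      rw [hv, if_neg (by simp [h2]), mul_zero]
    · rfl

/-- The probability that the code amplitude stretches some vector `ξ` by more than the factor
`(1 + η) / (1 - τ) ^ 2` beyond its mean-square value: a union bound of the tail estimate over a net
of radius `τ` in the unit ball. -/
lemma haar_exists_codeAmplitude_gt_le [Nonempty Z] [Nonempty M] {κ : ℝ}
    (hκ : 0 < κ)
    (hv : ∀ p p', ∑ y, v p y * star (v p' y) = if p = p' then (κ : ℂ) else 0)
    {η τ : ℝ} (hη : 0 < η) (hτ : 0 < τ) (hτ1 : τ < 1) (k : ℕ) :
    haarUnitary (Qubits P) {U | ∃ ξ : ι × X → ℂ,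
        (1 + η) / (1 - τ) ^ 2 * (κ * Fintype.card M / Fintype.card X) * ∑ p, ‖ξ p‖ ^ 2 <
          ∑ q, ‖∑ p, ξ p * codeAmplitude e v U p q‖ ^ 2} ≤
      ENNReal.ofReal (((1 + 2 / τ) ^ 2) ^ (Fintype.card ι * Fintype.card X) *
        ((1 + 4 * k / (Fintype.card Z * Fintype.card M)) / (1 + η)) ^ k) := by
  classical
  obtain ⟨s, hcard, hs1, hs2⟩ := exists_net_unitBall (EuclideanSpace ℂ (ι × X)) hτ
  have hfin : Module.finrank ℝ (EuclideanSpace ℂ (ι × X)) =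
      2 * (Fintype.card ι * Fintype.card X) := by
    rw [finrank_real_of_complex, finrank_euclideanSpace, Fintype.card_prod]
  rw [hfin, pow_mul] at hcard
  set T := (1 + 4 * (k : ℝ) / (Fintype.card Z * Fintype.card M)) / (1 + η) with hT
  set a : ℝ := (1 + η) * (κ * Fintype.card M / Fintype.card X) with ha
  have ha0 : 0 ≤ a := by positivity
  have hQ : (Fintype.card (Qubits P) : ℝ) = Fintype.card X * Fintype.card Z := by
    rw [← Fintype.card_congr e, Fintype.card_prod]
    push_cast
    ring
  have hZ : (Fintype.card Z : ℝ) ≠ 0 := by exact_mod_cast Fintype.card_ne_zero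
  have hsub : {U : unitaryGroup (Qubits P) ℂ | ∃ ξ : ι × X → ℂ,
        (1 + η) / (1 - τ) ^ 2 * (κ * Fintype.card M / Fintype.card X) * ∑ p, ‖ξ p‖ ^ 2 <
          ∑ q, ‖∑ p, ξ p * codeAmplitude e v U p q‖ ^ 2} ⊆
      ⋃ c ∈ s, {U | a ≤ weight (testMatrix e v c.ofLp) (U : Matrix _ _ ℂ)} := by
    rintro U ⟨ξ, hξ⟩
    by_contra hcon
    simp only [Set.mem_iUnion, Set.mem_ofPred_eq, not_exists, not_le] at hcon
    let W : EuclideanSpace ℂ (ι × X) →L[ℂ] EuclideanSpace ℂ (Z × M) :=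
      LinearMap.toContinuousLinearMap
        (Matrix.toEuclideanLin (codeAmplitude e v (U : Matrix _ _ ℂ))ᵀ)
    have hW : ∀ x : EuclideanSpace ℂ (ι × X), ‖W x‖ ^ 2 =
        ∑ q, ‖∑ p, x.ofLp p * codeAmplitude e v U p q‖ ^ 2 := by
      intro x
      rw [EuclideanSpace.norm_sq_eq]
      refine Finset.sum_congr rfl fun q _ => ?_
      congr 2
      simp only [W, LinearMap.coe_toContinuousLinearMap', Matrix.toLpLin_apply, Matrix.mulVec,
        dotProduct, Matrix.transpose_apply]
      exact Finset.sum_congr rfl fun p _ => mul_comm _ _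
    have hWc : ∀ c ∈ s, ‖W c‖ ≤ Real.sqrt a := by
      intro c hc
      refine Real.le_sqrt_of_sq_le ?_
      rw [hW]
      have := (hcon c hc).le
      unfold weight at this
      simpa only [trace_testMatrix_mul] using this
    have hop := opNorm_le_of_net W hτ1 (Real.sqrt_nonneg a) hs2 hWc
    have h1 := W.le_of_opNorm_le hop (WithLp.toLp 2 ξ)
    have h2 := pow_le_pow_left₀ (norm_nonneg _) h1 2
    rw [hW, mul_pow, div_pow, Real.sq_sqrt ha0, EuclideanSpace.norm_sq_eq] at h2
    refine absurd hξ (not_lt.2 (h2.trans_eq ?_))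
    rw [ha]
    ring
  refine (measure_mono hsub).trans ((measure_biUnion_finset_le s _).trans ?_)
  have hc : ∀ c ∈ s, haarUnitary (Qubits P)
      {U | a ≤ weight (testMatrix e v c.ofLp) (U : Matrix _ _ ℂ)} ≤ ENNReal.ofReal (T ^ k) := by
    intro c hc
    have hle : κ * ∑ p, ‖c.ofLp p‖ ^ 2 ≤ κ := by
      rw [← EuclideanSpace.norm_sq_eq]
      exact mul_le_of_le_one_right hκ.le (pow_le_one₀ (norm_nonneg _) (hs1 c hc))
    have h := haar_weight_ge_le (trace_testMatrix_mul_conjTranspose e v hv c.ofLp) hle hκ hη k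
    have haa : (1 + η) * (Fintype.card (Z × M) * κ / Fintype.card (Qubits P)) = a := by
      rw [ha, hQ, Fintype.card_prod, Nat.cast_mul]
      field_simp
    rw [haa] at h
    rw [hT]
    simpa only [Fintype.card_prod, Nat.cast_mul] using h
  refine (Finset.sum_le_sum hc).trans ?_
  have hT0 : 0 ≤ T := by positivity
  rw [Finset.sum_const, nsmul_eq_mul, ENNReal.ofReal_mul (by positivity)]
  gcongr
  rw [← ENNReal.ofReal_natCast]
  exact ENNReal.ofReal_le_ofReal hcard

end

end

noncomputable section

open Matrix
open scoped Kronecker ComplexOrder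

/-! ### Von Neumann entropy of Gram matrices -/

lemma vonNeumannEntropy_eq {X : Type} [Fintype X] [DecidableEq X] {ρ : Matrix X X ℂ}
    (h : ρ.IsHermitian) :
    vonNeumannEntropy ρ = (∑ i, Real.negMulLog (h.eigenvalues i)) / Real.log 2 := by
  unfold vonNeumannEntropy
  rw [dif_pos h]
  congr!

lemma vonNeumannEntropy_eq_roots {X : Type} [Fintype X] [DecidableEq X] {ρ : Matrix X X ℂ}
    (h : ρ.IsHermitian) :
    vonNeumannEntropy ρ =
      (ρ.charpoly.roots.map fun z => Real.negMulLog z.re).sum / Real.log 2 := by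
  rw [vonNeumannEntropy_eq h, h.roots_charpoly_eq_eigenvalues, Multiset.map_map]
  simp

lemma vonNeumannEntropy_transpose {X : Type} [Fintype X] {ρ : Matrix X X ℂ}
    (h : ρ.IsHermitian) : vonNeumannEntropy ρᵀ = vonNeumannEntropy ρ := by
  classical
  rw [vonNeumannEntropy_eq_roots h, vonNeumannEntropy_eq_roots h.transpose, charpoly_transpose]

/-- The two marginals of a bipartite pure state have the same entropy. -/
lemma vonNeumannEntropy_mul_conjTranspose_comm {X Z : Type} [Fintype X] [Fintype Z]
    (A : Matrix X Z ℂ) : vonNeumannEntropy (A * Aᴴ) = vonNeumannEntropy (Aᴴ * A) := by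
  classical
  rw [vonNeumannEntropy_eq_roots (isHermitian_mul_conjTranspose_self A),
    vonNeumannEntropy_eq_roots (isHermitian_conjTranspose_mul_self A)]
  have h := congrArg Polynomial.roots (charpoly_mul_comm' A Aᴴ)
  rw [Polynomial.roots_mul (mul_ne_zero (pow_ne_zero _ Polynomial.X_ne_zero)
      (charpoly_monic _).ne_zero),
    Polynomial.roots_mul (mul_ne_zero (pow_ne_zero _ Polynomial.X_ne_zero)
      (charpoly_monic _).ne_zero), Polynomial.roots_pow, Polynomial.roots_pow,
    Polynomial.roots_X] at h
  have h2 := congrArg (fun s : Multiset ℂ => (s.map fun z => Real.negMulLog z.re).sum) h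
  simpa [Multiset.map_nsmul, Multiset.sum_nsmul] using congrArg (· / Real.log 2) h2

lemma sum_eigenvalues_eq_one {X : Type} [Fintype X] [DecidableEq X] {ρ : Matrix X X ℂ}
    (h : ρ.IsHermitian) (htr : trace ρ = 1) : ∑ i, h.eigenvalues i = 1 := by
  have := h.trace_eq_sum_eigenvalues
  rw [htr] at this
  apply Complex.ofReal_injective
  rw [Complex.ofReal_sum, Complex.ofReal_one]
  exact this.symm

lemma vonNeumannEntropy_nonneg {X : Type} [Fintype X] {ρ : Matrix X X ℂ}
    (h : ρ.PosSemidef) (htr : trace ρ = 1) : 0 ≤ vonNeumannEntropy ρ := by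
  classical
  rw [vonNeumannEntropy_eq h.1]
  refine div_nonneg (Finset.sum_nonneg fun i _ => Real.negMulLog_nonneg (h.eigenvalues_nonneg i) ?_)
    (Real.log_nonneg one_le_two)
  rw [← sum_eigenvalues_eq_one h.1 htr]
  exact Finset.single_le_sum (fun j _ => h.eigenvalues_nonneg j) (Finset.mem_univ i)

/-- The entropy of a density matrix is at most the logarithm of the dimension. -/
lemma vonNeumannEntropy_le {X : Type} [Fintype X] {ρ : Matrix X X ℂ}
    (h : ρ.PosSemidef) (htr : trace ρ = 1) :
    vonNeumannEntropy ρ ≤ Real.log (Fintype.card X) / Real.log 2 := by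
  classical
  rw [vonNeumannEntropy_eq h.1]
  refine div_le_div_of_nonneg_right ?_ (Real.log_nonneg one_le_two)
  have h1 := sum_eigenvalues_eq_one h.1 htr
  have hX : Nonempty X := by
    by_contra hX
    rw [not_nonempty_iff] at hX
    simp at h1
  have hn : 0 < (Fintype.card X : ℝ) := by exact_mod_cast Fintype.card_pos
  have h2 : ∀ i, Real.negMulLog (h.1.eigenvalues i) ≤
      h.1.eigenvalues i * Real.log (Fintype.card X) +
        ((Fintype.card X : ℝ)⁻¹ - h.1.eigenvalues i) := by
    intro i
    rcases (h.eigenvalues_nonneg i).eq_or_lt with h0 | h0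
    · rw [← h0]
      simp
    · have h3 := Real.log_le_sub_one_of_pos (x := ((Fintype.card X : ℝ) * h.1.eigenvalues i)⁻¹)
        (by positivity)
      rw [Real.log_inv, Real.log_mul hn.ne' h0.ne'] at h3
      have h4 := mul_le_mul_of_nonneg_left h3 h0.le
      have h5 : h.1.eigenvalues i * ((Fintype.card X : ℝ) * h.1.eigenvalues i)⁻¹ =
          (Fintype.card X : ℝ)⁻¹ := by
        field_simp
      rw [Real.negMulLog]
      linarith
  refine (Finset.sum_le_sum fun i _ => h2 i).trans_eq ?_
  rw [Finset.sum_add_distrib, ← Finset.sum_mul, Finset.sum_sub_distrib, h1, Finset.sum_const,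
    Finset.card_univ, nsmul_eq_mul, mul_inv_cancel₀ hn.ne']
  ring

/-- Gibbs' inequality for a state `∑ i, p i |u i⟩⟨u i|` which is dominated, as a quadratic form, by
the diagonal matrix `D`; the `u i` are the columns of `U`. The bound `p i * ∑ k, ‖U k i‖² / D k ≤ 1`
comes from testing the domination on the vector `conj (U k i) / D k`. -/
lemma neg_sum_mul_log_le {K : Type} [Fintype K] {p D : K → ℝ} (U : Matrix K K ℂ)
    (hp : ∀ i, 0 ≤ p i) (hD : ∀ k, 0 ≤ D k) (hU : ∀ i, ∑ k, ‖U k i‖ ^ 2 = 1)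
    (h : ∀ ξ : K → ℂ, ∑ i, p i * ‖∑ k, ξ k * U k i‖ ^ 2 ≤ ∑ k, D k * ‖ξ k‖ ^ 2) :
    -∑ k, (∑ i, p i * ‖U k i‖ ^ 2) * Real.log (D k) ≤ ∑ i, Real.negMulLog (p i) := by
  classical
  have hzero : ∀ i k, D k = 0 → p i * ‖U k i‖ ^ 2 = 0 := by
    intro i k hk
    have h1 := h (Pi.single k 1)
    have h2 : ∑ l, D l * ‖(Pi.single k 1 : K → ℂ) l‖ ^ 2 = 0 := by
      rw [Finset.sum_eq_single k]
      · simp [hk]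
      · intro l _ hl
        simp [hl]
      · simp
    have h3 : ∀ i, ∑ l, (Pi.single k 1 : K → ℂ) l * U l i = U k i := by
      intro i
      rw [Finset.sum_eq_single k]
      · simp
      · intro l _ hl
        simp [hl]
      · simp
    simp only [h2, h3] at h1
    refine le_antisymm ?_ (mul_nonneg (hp i) (sq_nonneg _))
    exact (Finset.single_le_sum (f := fun i => p i * ‖U k i‖ ^ 2)
      (fun j _ => mul_nonneg (hp j) (sq_nonneg _)) (Finset.mem_univ i)).trans h1
  have hone : ∀ i, p i * ∑ k, ‖U k i‖ ^ 2 / D k ≤ 1 := by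
    intro i
    set t := ∑ k, ‖U k i‖ ^ 2 / D k with ht
    have ht0 : 0 ≤ t := Finset.sum_nonneg fun k _ => div_nonneg (sq_nonneg _) (hD k)
    have h1 := h fun k => star (U k i) / (D k : ℂ)
    have h2 : ∑ k, D k * ‖star (U k i) / (D k : ℂ)‖ ^ 2 = t := by
      refine Finset.sum_congr rfl fun k _ => ?_
      rw [norm_div, norm_star, Complex.norm_real, Real.norm_of_nonneg (hD k), div_pow]
      by_cases hk : D k = 0
      · simp [hk]
      · field_simp
    have h3 : ∑ k, star (U k i) / (D k : ℂ) * U k i = (t : ℂ) := by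
      rw [ht, Complex.ofReal_sum]
      refine Finset.sum_congr rfl fun k _ => ?_
      rw [Complex.ofReal_div, Complex.ofReal_pow, ← Complex.conj_mul']
      simp only [RCLike.star_def]
      ring
    have h4 := (Finset.single_le_sum (f := fun j => p j * ‖∑ k, star (U k i) / (D k : ℂ) * U k j‖ ^ 2)
      (fun j _ => mul_nonneg (hp j) (sq_nonneg _)) (Finset.mem_univ i)).trans (h1.trans_eq h2)
    rw [h3, Complex.norm_real, Real.norm_of_nonneg ht0] at h4
    rcases ht0.eq_or_lt with h0 | h0
    · rw [← h0]
      simp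
    · refine le_of_mul_le_mul_right ?_ h0
      linarith
  have hterm : ∀ i, -∑ k, p i * ‖U k i‖ ^ 2 * Real.log (D k) ≤ Real.negMulLog (p i) := by
    intro i
    rcases (hp i).eq_or_lt with h0 | h0
    · rw [← h0]
      simp
    · have h1 : ∀ k, ‖U k i‖ ^ 2 * (Real.log (p i) - Real.log (D k)) ≤
          p i * (‖U k i‖ ^ 2 / D k) - ‖U k i‖ ^ 2 := by
        intro k
        rcases (hD k).eq_or_lt with hk | hk
        · have := (mul_eq_zero.1 (hzero i k hk.symm)).resolve_left h0.ne'
          rw [this]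
          simp
        · have h2 := Real.log_le_sub_one_of_pos (div_pos h0 hk)
          rw [Real.log_div h0.ne' hk.ne'] at h2
          refine (mul_le_mul_of_nonneg_left h2 (sq_nonneg _)).trans_eq ?_
          ring
      have h3 := Finset.sum_le_sum fun k (_ : k ∈ Finset.univ) => h1 k
      simp only [mul_sub, Finset.sum_sub_distrib] at h3
      rw [← Finset.mul_sum, ← Finset.sum_mul, hU i] at h3
      have h4 : Real.log (p i) - ∑ k, ‖U k i‖ ^ 2 * Real.log (D k) ≤ 0 := by linarith [hone i]
      have h5 := mul_le_mul_of_nonneg_left h4 h0.le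
      rw [mul_sub, Finset.mul_sum, mul_zero] at h5
      simp only [mul_assoc]
      rw [Real.negMulLog]
      linarith
  refine le_trans (le_of_eq ?_) (Finset.sum_le_sum fun i _ => hterm i)
  rw [Finset.sum_neg_distrib, Finset.sum_comm]
  simp only [Finset.sum_mul]

lemma neg_sum_mul_log_le_vonNeumannEntropy {K Z : Type} [Fintype K] [Fintype Z]
    (A : Matrix K Z ℂ) {D : K → ℝ} (hD : ∀ k, 0 ≤ D k)
    (h : ∀ ξ : K → ℂ, ∑ z, ‖∑ k, ξ k * A k z‖ ^ 2 ≤ ∑ k, D k * ‖ξ k‖ ^ 2) :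
    (-∑ k, (∑ z, ‖A k z‖ ^ 2) * Real.log (D k)) / Real.log 2 ≤ vonNeumannEntropy (A * Aᴴ) := by
  classical
  have hP : (A * Aᴴ).PosSemidef := posSemidef_self_mul_conjTranspose A
  set p := hP.1.eigenvalues with hp
  set U : Matrix K K ℂ := (hP.1.eigenvectorUnitary : Matrix K K ℂ) with hU
  have hspec : A * Aᴴ = U * diagonal (fun i => (p i : ℂ)) * Uᴴ := hP.1.spectral_theorem
  have hentry : ∀ k l, ∑ z, A k z * star (A l z) = ∑ i, p i * (U k i * star (U l i)) := by
    intro k l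
    have := congrFun (congrFun hspec k) l
    rw [Matrix.mul_apply, Matrix.mul_apply] at this
    simp only [Matrix.mul_diagonal, conjTranspose_apply] at this
    rw [this]
    exact Finset.sum_congr rfl fun i _ => by ring
  have hquad : ∀ ξ : K → ℂ, ∑ i, p i * ‖∑ k, ξ k * U k i‖ ^ 2 = ∑ z, ‖∑ k, ξ k * A k z‖ ^ 2 := by
    intro ξ
    have h1 : ((∑ i, p i * ‖∑ k, ξ k * U k i‖ ^ 2 : ℝ) : ℂ) =
        ∑ k, ∑ l, ξ k * star (ξ l) * ∑ i, p i * (U k i * star (U l i)) := by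
      simp only [Finset.mul_sum]
      rw [Complex.ofReal_sum]
      simp_rw [Complex.ofReal_mul, Complex.ofReal_pow, ← Complex.mul_conj', map_sum,
        Finset.sum_mul_sum, Finset.mul_sum]
      rw [Finset.sum_comm]
      refine Finset.sum_congr rfl fun k _ => ?_
      rw [Finset.sum_comm]
      refine Finset.sum_congr rfl fun l _ => Finset.sum_congr rfl fun i _ => ?_
      simp
      ring
    have h2 : ((∑ z, ‖∑ k, ξ k * A k z‖ ^ 2 : ℝ) : ℂ) =
        ∑ k, ∑ l, ξ k * star (ξ l) * ∑ z, A k z * star (A l z) := by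
      simp only [Finset.mul_sum]
      rw [Complex.ofReal_sum]
      simp_rw [Complex.ofReal_pow, ← Complex.mul_conj', map_sum, Finset.sum_mul_sum]
      rw [Finset.sum_comm]
      refine Finset.sum_congr rfl fun k _ => ?_
      rw [Finset.sum_comm]
      refine Finset.sum_congr rfl fun l _ => Finset.sum_congr rfl fun i _ => ?_
      simp
      ring
    simp_rw [hentry] at h2
    exact_mod_cast h1.trans h2.symm
  have hdiag : ∀ k, ∑ i, p i * ‖U k i‖ ^ 2 = ∑ z, ‖A k z‖ ^ 2 := by
    intro k
    have := hquad (Pi.single k 1)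
    simpa [Pi.single_apply] using this
  have hcol : ∀ i, ∑ k, ‖U k i‖ ^ 2 = 1 := by
    intro i
    have h1 : Uᴴ * U = 1 := Unitary.coe_star_mul_self _
    have h2 := congrFun (congrFun h1 i) i
    simp only [Matrix.mul_apply, conjTranspose_apply, one_apply_eq] at h2
    have h3 : ((∑ k, ‖U k i‖ ^ 2 : ℝ) : ℂ) = 1 := by
      rw [← h2, Complex.ofReal_sum]
      refine Finset.sum_congr rfl fun k _ => ?_
      rw [Complex.ofReal_pow, ← Complex.conj_mul']
      rfl
    exact_mod_cast h3
  rw [vonNeumannEntropy_eq hP.1]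
  refine div_le_div_of_nonneg_right ?_ (Real.log_nonneg one_le_two)
  simp_rw [← hdiag]
  exact neg_sum_mul_log_le U hP.eigenvalues_nonneg hD hcol fun ξ => (hquad ξ).trans_le (h ξ)

/-! ### Mutual information of an encoded secret -/

section

variable {R X Z : Type} [Fintype R] [Fintype X] [Fintype Z]

/-- Exchange of the roles of the kept register `X` and the discarded register `Z` in the amplitude
of a pure state of `R`, `X` and `Z`. -/
def swapAmplitude (A : Matrix (R × X) Z ℂ) : Matrix (R × Z) X ℂ :=
  fun p x => A (p.1, x) p.2

/-- The amplitude `A` maps an orthonormal basis of the secret's register to orthonormal vectors. -/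
def IsEncodingAmplitude [DecidableEq R] (A : Matrix (R × X) Z ℂ) : Prop :=
  ∀ r r', ∑ x, ∑ z, A (r, x) z * star (A (r', x) z) = if r = r' then 1 else 0

/-- As a quadratic form, `A * Aᴴ` is at most `c / |X|` times the identity. -/
def IsDominated (A : Matrix (R × X) Z ℂ) (c : ℝ) : Prop :=
  ∀ ξ : R × X → ℂ, ∑ z, ‖∑ p, ξ p * A p z‖ ^ 2 ≤ c / Fintype.card X * ∑ p, ‖ξ p‖ ^ 2

omit [Fintype Z] in
lemma kronecker_one_mul_apply [DecidableEq X] (A : Matrix (R × X) Z ℂ) (φ : Matrix R R ℂ)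
    (r : R) (x : X) (z : Z) :
    (φ ⊗ₖ (1 : Matrix X X ℂ) * A) (r, x) z = ∑ s, φ r s * A (s, x) z := by
  rw [Matrix.mul_apply, Fintype.sum_prod_type]
  refine Finset.sum_congr rfl fun s _ => ?_
  simp [kroneckerMap_apply, Matrix.one_apply]

lemma traceSnd_kronecker_mul [DecidableEq R] [DecidableEq X] {A : Matrix (R × X) Z ℂ}
    (hA : IsEncodingAmplitude A) (φ : Matrix R R ℂ) :
    traceSnd ((φ ⊗ₖ (1 : Matrix X X ℂ) * A) * (φ ⊗ₖ (1 : Matrix X X ℂ) * A)ᴴ) = φ * φᴴ := by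
  ext r r'
  simp only [traceSnd, Matrix.mul_apply (N := (_ : Matrix _ _ ℂ)ᴴ), conjTranspose_apply,
    kronecker_one_mul_apply]
  simp only [star_sum, Finset.sum_mul_sum]
  have h : ∀ s s', ∑ x, ∑ z, (φ r s * A (s, x) z) * star (φ r' s' * A (s', x) z) =
      φ r s * star (φ r' s') * if s = s' then 1 else 0 := by
    intro s s'
    rw [← hA s s', Finset.mul_sum]
    refine Finset.sum_congr rfl fun x _ => ?_
    rw [Finset.mul_sum]
    refine Finset.sum_congr rfl fun z _ => ?_
    rw [star_mul']
    ring
  calc ∑ x, ∑ z, ∑ s, ∑ s', φ r s * A (s, x) z * star (φ r' s' * A (s', x) z)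
      = ∑ s, ∑ s', ∑ x, ∑ z, φ r s * A (s, x) z * star (φ r' s' * A (s', x) z) := by
        simp_rw [Finset.sum_comm (s := (Finset.univ : Finset Z)) (t := (Finset.univ : Finset R)),
          Finset.sum_comm (s := (Finset.univ : Finset X)) (t := (Finset.univ : Finset R))]
    _ = ∑ s, φ r s * star (φ r' s) := by
        simp_rw [h]
        simp

/-- A dominated code amplitude gives a state which is nearly the product of the marginal of `R`
with the maximally mixed state; this bounds its entropy from below. The secret may be taken in its
Schmidt basis, because the entropy is that of the discarded register. -/
lemma le_vonNeumannEntropy_of_isDominated [DecidableEq R] [DecidableEq X] [Nonempty X]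
    {A : Matrix (R × X) Z ℂ} (hA : IsEncodingAmplitude A) {c : ℝ} (hc : 0 < c)
    (hdom : IsDominated A c) {φ : Matrix R R ℂ} (hφ : trace (φ * φᴴ) = 1) :
    vonNeumannEntropy (φ * φᴴ) + Real.log (Fintype.card X) / Real.log 2 -
        Real.log c / Real.log 2 ≤
      vonNeumannEntropy ((φ ⊗ₖ (1 : Matrix X X ℂ) * A) * (φ ⊗ₖ (1 : Matrix X X ℂ) * A)ᴴ) := by
  have hσ : (φ * φᴴ).PosSemidef := posSemidef_self_mul_conjTranspose φ
  set q := hσ.1.eigenvalues with hq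
  set V : Matrix R R ℂ := (hσ.1.eigenvectorUnitary : Matrix R R ℂ) with hV
  have hVV : V * Vᴴ = 1 := Unitary.coe_mul_star_self _
  have hVV' : Vᴴ * V = 1 := Unitary.coe_star_mul_self _
  have hspec : φ * φᴴ = V * diagonal (fun i => (q i : ℂ)) * Vᴴ := hσ.1.spectral_theorem
  set ψ : Matrix R R ℂ := Vᴴ * φ with hψ
  have hψψ : ψ * ψᴴ = diagonal (fun i => (q i : ℂ)) := by
    rw [hψ, conjTranspose_mul, conjTranspose_conjTranspose, Matrix.mul_assoc,
      ← Matrix.mul_assoc φ, hspec]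
    simp only [Matrix.mul_assoc]
    rw [hVV', Matrix.mul_one, ← Matrix.mul_assoc, hVV', Matrix.one_mul]
  have hent : vonNeumannEntropy ((φ ⊗ₖ (1 : Matrix X X ℂ) * A) *
      (φ ⊗ₖ (1 : Matrix X X ℂ) * A)ᴴ) = vonNeumannEntropy ((ψ ⊗ₖ (1 : Matrix X X ℂ) * A) *
      (ψ ⊗ₖ (1 : Matrix X X ℂ) * A)ᴴ) := by
    have hφψ : ψ ⊗ₖ (1 : Matrix X X ℂ) = Vᴴ ⊗ₖ (1 : Matrix X X ℂ) * φ ⊗ₖ (1 : Matrix X X ℂ) := by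
      rw [← mul_kronecker_mul, Matrix.one_mul]
    have hW : (Vᴴ ⊗ₖ (1 : Matrix X X ℂ))ᴴ * Vᴴ ⊗ₖ (1 : Matrix X X ℂ) = 1 := by
      rw [conjTranspose_kronecker, conjTranspose_conjTranspose, conjTranspose_one,
        ← mul_kronecker_mul, hVV, Matrix.one_mul, one_kronecker_one]
    rw [vonNeumannEntropy_mul_conjTranspose_comm, vonNeumannEntropy_mul_conjTranspose_comm, hφψ,
      Matrix.mul_assoc (Vᴴ ⊗ₖ (1 : Matrix X X ℂ)), conjTranspose_mul (Vᴴ ⊗ₖ (1 : Matrix X X ℂ)),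
      Matrix.mul_assoc _ _ (Vᴴ ⊗ₖ (1 : Matrix X X ℂ) * _), ← Matrix.mul_assoc _ (Vᴴ ⊗ₖ _), hW,
      Matrix.one_mul]
  have hψ2 : ∀ ζ : R → ℂ, ∑ s, ‖∑ r, ζ r * ψ r s‖ ^ 2 = ∑ r, q r * ‖ζ r‖ ^ 2 := by
    intro ζ
    have h1 : ((∑ s, ‖∑ r, ζ r * ψ r s‖ ^ 2 : ℝ) : ℂ) =
        ∑ r, ∑ r', ζ r * star (ζ r') * (ψ * ψᴴ) r r' := by
      simp only [Matrix.mul_apply, conjTranspose_apply, Finset.mul_sum]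
      rw [Complex.ofReal_sum]
      simp_rw [Complex.ofReal_pow, ← Complex.mul_conj', map_sum, Finset.sum_mul_sum]
      rw [Finset.sum_comm]
      refine Finset.sum_congr rfl fun k _ => ?_
      rw [Finset.sum_comm]
      refine Finset.sum_congr rfl fun l _ => Finset.sum_congr rfl fun i _ => ?_
      simp
      ring
    have h2 : ((∑ r, q r * ‖ζ r‖ ^ 2 : ℝ) : ℂ) = ∑ r, ∑ r', ζ r * star (ζ r') * (ψ * ψᴴ) r r' := by
      rw [hψψ, Complex.ofReal_sum]
      refine Finset.sum_congr rfl fun r _ => ?_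
      rw [Finset.sum_eq_single r]
      · rw [diagonal_apply_eq, Complex.ofReal_mul, Complex.ofReal_pow, ← Complex.mul_conj']
        simp only [RCLike.star_def]
        ring
      · intro r' _ hr'
        rw [diagonal_apply_ne _ (Ne.symm hr'), mul_zero]
      · simp
    exact_mod_cast h1.trans h2.symm
  have hX : 0 < (Fintype.card X : ℝ) := by exact_mod_cast Fintype.card_pos
  have hq0 : ∀ r, 0 ≤ q r := hσ.eigenvalues_nonneg
  set D : R × X → ℝ := fun p => c / Fintype.card X * q p.1 with hD
  have hD0 : ∀ p, 0 ≤ D p := fun p => mul_nonneg (by positivity) (hq0 _)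
  have hdom' : ∀ ξ : R × X → ℂ,
      ∑ z, ‖∑ p, ξ p * (ψ ⊗ₖ (1 : Matrix X X ℂ) * A) p z‖ ^ 2 ≤ ∑ p, D p * ‖ξ p‖ ^ 2 := by
    intro ξ
    have h1 := hdom fun p => ∑ r, ξ (r, p.2) * ψ r p.1
    have h2 : ∀ z, ∑ p : R × X, ξ p * (ψ ⊗ₖ (1 : Matrix X X ℂ) * A) p z =
        ∑ p : R × X, (∑ r, ξ (r, p.2) * ψ r p.1) * A p z := by
      intro z
      rw [Fintype.sum_prod_type_right, Fintype.sum_prod_type_right]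
      refine Finset.sum_congr rfl fun x _ => ?_
      simp only [kronecker_one_mul_apply, Finset.mul_sum, Finset.sum_mul]
      rw [Finset.sum_comm]
      exact Finset.sum_congr rfl fun s _ => Finset.sum_congr rfl fun r _ => by ring
    have h3 : ∑ p : R × X, D p * ‖ξ p‖ ^ 2 =
        c / Fintype.card X * ∑ p : R × X, ‖∑ r, ξ (r, p.2) * ψ r p.1‖ ^ 2 := by
      rw [Fintype.sum_prod_type_right, Fintype.sum_prod_type_right, Finset.mul_sum]
      refine Finset.sum_congr rfl fun x _ => ?_
      rw [hψ2 fun r => ξ (r, x), Finset.mul_sum]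
      exact Finset.sum_congr rfl fun r _ => by rw [hD]; ring
    simp_rw [h2]
    rw [h3]
    exact h1
  have hdiag : ∀ r, ∑ x, ∑ z, ‖(ψ ⊗ₖ (1 : Matrix X X ℂ) * A) (r, x) z‖ ^ 2 = q r := by
    intro r
    have h1 := congrFun (congrFun (traceSnd_kronecker_mul hA ψ) r) r
    rw [hψψ, diagonal_apply_eq] at h1
    simp only [traceSnd] at h1
    simp only [Matrix.mul_apply (N := (_ : Matrix _ _ ℂ)ᴴ), conjTranspose_apply] at h1
    have h2 : ((∑ x, ∑ z, ‖(ψ ⊗ₖ (1 : Matrix X X ℂ) * A) (r, x) z‖ ^ 2 : ℝ) : ℂ) = q r := by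
      rw [← h1, Complex.ofReal_sum]
      refine Finset.sum_congr rfl fun x _ => ?_
      rw [Complex.ofReal_sum]
      refine Finset.sum_congr rfl fun z _ => ?_
      rw [Complex.ofReal_pow, ← Complex.mul_conj']
      rfl
    exact_mod_cast h2
  rw [hent]
  refine le_trans (le_of_eq ?_) (neg_sum_mul_log_le_vonNeumannEntropy _ hD0 hdom')
  rw [vonNeumannEntropy_eq hσ.1, ← add_div, ← sub_div]
  congr 1
  rw [Fintype.sum_prod_type]
  simp only [hD]
  have h1 : ∀ r, ∑ x, (∑ z, ‖(ψ ⊗ₖ (1 : Matrix X X ℂ) * A) (r, x) z‖ ^ 2) *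
      Real.log (c / Fintype.card X * q r) =
      q r * (Real.log c - Real.log (Fintype.card X)) - Real.negMulLog (q r) := by
    intro r
    rw [← Finset.sum_mul, hdiag, Real.negMulLog]
    rcases (hq0 r).eq_or_lt with h0 | h0
    · rw [← h0]
      simp
    · rw [Real.log_mul (by positivity) h0.ne', Real.log_div hc.ne' hX.ne']
      ring
  simp_rw [h1]
  rw [Finset.sum_sub_distrib, ← Finset.sum_mul, sum_eigenvalues_eq_one hσ.1 hφ]
  ring

omit [Fintype X] in
lemma traceFst_mul_conjTranspose (A : Matrix (R × X) Z ℂ) :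
    traceFst (A * Aᴴ) = ((swapAmplitude A)ᴴ * swapAmplitude A)ᵀ := by
  ext x x'
  simp only [traceFst, Matrix.mul_apply, conjTranspose_apply, transpose_apply, swapAmplitude,
    Fintype.sum_prod_type]
  exact Finset.sum_congr rfl fun r _ => Finset.sum_congr rfl fun z _ => mul_comm _ _

lemma swapAmplitude_kronecker_mul [DecidableEq X] [DecidableEq Z] (A : Matrix (R × X) Z ℂ)
    (φ : Matrix R R ℂ) : swapAmplitude (φ ⊗ₖ (1 : Matrix X X ℂ) * A) =
      φ ⊗ₖ (1 : Matrix Z Z ℂ) * swapAmplitude A := by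
  ext ⟨r, z⟩ x
  simp only [swapAmplitude, kronecker_one_mul_apply]

omit [Fintype R] in
lemma IsEncodingAmplitude.swap [DecidableEq R] {A : Matrix (R × X) Z ℂ}
    (hA : IsEncodingAmplitude A) : IsEncodingAmplitude (swapAmplitude A) := by
  intro r r'
  rw [← hA r r', Finset.sum_comm]
  rfl

lemma trace_traceSnd (ρ : Matrix (R × X) (R × X) ℂ) : trace (traceSnd ρ) = trace ρ := by
  simp [trace, traceSnd, Fintype.sum_prod_type]

lemma trace_traceFst (ρ : Matrix (R × X) (R × X) ℂ) : trace (traceFst ρ) = trace ρ := by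
  simp [trace, traceFst, Fintype.sum_prod_type_right]

/-- The mutual information in terms of the entropies of `R`, of `R` with the discarded register,
and of the discarded register alone. -/
lemma mutualInfo_kronecker_mul [DecidableEq R] [DecidableEq X] [DecidableEq Z]
    {A : Matrix (R × X) Z ℂ}
    (hA : IsEncodingAmplitude A) (φ : Matrix R R ℂ) :
    mutualInfo ((φ ⊗ₖ (1 : Matrix X X ℂ) * A) * (φ ⊗ₖ (1 : Matrix X X ℂ) * A)ᴴ) =
      vonNeumannEntropy (φ * φᴴ) +
        vonNeumannEntropy ((φ ⊗ₖ (1 : Matrix Z Z ℂ) * swapAmplitude A) *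
          (φ ⊗ₖ (1 : Matrix Z Z ℂ) * swapAmplitude A)ᴴ) -
        vonNeumannEntropy ((φ ⊗ₖ (1 : Matrix X X ℂ) * A) * (φ ⊗ₖ (1 : Matrix X X ℂ) * A)ᴴ) := by
  unfold mutualInfo
  rw [traceSnd_kronecker_mul hA, traceFst_mul_conjTranspose, vonNeumannEntropy_transpose
    (isHermitian_conjTranspose_mul_self _), ← vonNeumannEntropy_mul_conjTranspose_comm,
    swapAmplitude_kronecker_mul]

/-- Secrecy: a dominated amplitude leaves almost no correlation between `R` and the kept register. -/
lemma mutualInfo_le_of_isDominated [DecidableEq R] [DecidableEq X] [Nonempty X]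
    {A : Matrix (R × X) Z ℂ} (hA : IsEncodingAmplitude A) {c : ℝ} (hc : 0 < c)
    (hdom : IsDominated A c) {φ : Matrix R R ℂ} (hφ : trace (φ * φᴴ) = 1) :
    mutualInfo ((φ ⊗ₖ (1 : Matrix X X ℂ) * A) * (φ ⊗ₖ (1 : Matrix X X ℂ) * A)ᴴ) ≤
      Real.log c / Real.log 2 := by
  have h1 := le_vonNeumannEntropy_of_isDominated hA hc hdom hφ
  unfold mutualInfo
  rw [traceSnd_kronecker_mul hA]
  set ρ := (φ ⊗ₖ (1 : Matrix X X ℂ) * A) * (φ ⊗ₖ (1 : Matrix X X ℂ) * A)ᴴ with hρ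
  have htr : trace (traceFst ρ) = 1 := by
    rw [trace_traceFst, ← trace_traceSnd, hρ, traceSnd_kronecker_mul hA, hφ]
  have hpos : (traceFst ρ).PosSemidef := by
    rw [hρ, traceFst_mul_conjTranspose]
    exact (posSemidef_conjTranspose_mul_self _).transpose
  linarith [vonNeumannEntropy_le hpos htr]

/-- Recoverability: if the discarded register is almost uncorrelated with `R`, then the kept one
has almost the maximal correlation `2 S(R)`. -/
lemma le_mutualInfo_of_isDominated_swap [DecidableEq R] [DecidableEq X] [Nonempty Z]
    {A : Matrix (R × X) Z ℂ} (hA : IsEncodingAmplitude A) {c : ℝ} (hc : 0 < c)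
    (hdom : IsDominated (swapAmplitude A) c) {φ : Matrix R R ℂ} (hφ : trace (φ * φᴴ) = 1) :
    2 * vonNeumannEntropy (φ * φᴴ) - Real.log c / Real.log 2 ≤
      mutualInfo ((φ ⊗ₖ (1 : Matrix X X ℂ) * A) * (φ ⊗ₖ (1 : Matrix X X ℂ) * A)ᴴ) := by
  classical
  have h1 := le_vonNeumannEntropy_of_isDominated hA.swap hc hdom hφ
  rw [mutualInfo_kronecker_mul hA, vonNeumannEntropy_mul_conjTranspose_comm
    (φ ⊗ₖ (1 : Matrix X X ℂ) * A)]
  have htr : trace ((φ ⊗ₖ (1 : Matrix X X ℂ) * A)ᴴ * (φ ⊗ₖ (1 : Matrix X X ℂ) * A)) = 1 := by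
    rw [trace_mul_comm, ← trace_traceSnd, traceSnd_kronecker_mul hA, hφ]
  linarith [vonNeumannEntropy_le (posSemidef_conjTranspose_mul_self _) htr]

omit [Fintype X] [Fintype Z] in
lemma mutualInfo_pureDensity_le {φ : R × R → ℂ}
    (hφ : trace ((Matrix.of fun r s => φ (r, s)) * (Matrix.of fun r s => φ (r, s))ᴴ) = 1) :
    mutualInfo (pureDensity φ) ≤ 2 * vonNeumannEntropy
      ((Matrix.of fun r s => φ (r, s)) * (Matrix.of fun r s => φ (r, s))ᴴ) := by
  set F : Matrix R R ℂ := Matrix.of fun r s => φ (r, s) with hF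
  have h1 : traceSnd (pureDensity φ) = F * Fᴴ := by
    ext r r'
    simp [traceSnd, pureDensity, Matrix.mul_apply, hF]
  have h2 : traceFst (pureDensity φ) = (Fᴴ * F)ᵀ := by
    ext r r'
    simp only [traceFst, pureDensity, Matrix.mul_apply, hF, transpose_apply, conjTranspose_apply,
      Matrix.of_apply]
    exact Finset.sum_congr rfl fun _ _ => mul_comm _ _
  have h3 : (pureDensity φ).PosSemidef := posSemidef_vecMulVec_self_star φ
  have h4 : trace (pureDensity φ) = 1 := by
    rw [← trace_traceSnd, h1, hφ]
  unfold mutualInfo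
  rw [h1, h2, vonNeumannEntropy_transpose (isHermitian_conjTranspose_mul_self _),
    ← vonNeumannEntropy_mul_conjTranspose_comm]
  linarith [vonNeumannEntropy_nonneg h3 h4]

end

end

noncomputable section

open Matrix
open scoped Kronecker

/-! ### Scrambled codes -/

section

variable {T M : Type} [Fintype T] [DecidableEq T] [Fintype M] [DecidableEq M]

/-- The input `|r⟩ₐ |χ⟩` of the scrambling unitary for the basis state `r` of the secret, with the
memory projected on its basis state `m`. -/
def inputVector (a : T) (χ : Qubits {t // t ≠ a} × M → ℂ) (p : Fin 2 × M) (y : Qubits T) : ℂ :=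
  if y a = p.1 then χ (fun t => y t, p.2) else 0

omit [Fintype M] in
lemma sum_inputVector_mul_star (a : T) {χ : Qubits {t // t ≠ a} × M → ℂ} {κ : ℝ}
    (hχ : ∀ m m', ∑ b, χ (b, m) * star (χ (b, m')) = if m = m' then (κ : ℂ) else 0)
    (p p' : Fin 2 × M) :
    ∑ y, inputVector a χ p y * star (inputVector a χ p' y) =
      if p = p' then (κ : ℂ) else 0 := by
  obtain ⟨g, hg⟩ : ∃ g : Fin 2 × Qubits {t // t ≠ a} → ℂ, g = fun w =>
      if w.1 = p.1 ∧ w.1 = p'.1 then χ (w.2, p.2) * star (χ (w.2, p'.2)) else 0 := ⟨_, rfl⟩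
  have h : ∀ y : Qubits T, inputVector a χ p y * star (inputVector a χ p' y) =
      g (Equiv.funSplitAt a (Fin 2) y) := by
    intro y
    have h1 : (Equiv.funSplitAt a (Fin 2) y) = (y a, fun t => y t.1) := rfl
    rw [h1, hg]
    unfold inputVector
    by_cases h : y a = p.1 <;> by_cases h' : y a = p'.1 <;> simp [h, h']
    all_goals simp_all
  rw [Finset.sum_congr rfl fun y _ => h y, Equiv.sum_comp (Equiv.funSplitAt a (Fin 2)) g, hg]
  rw [Fintype.sum_prod_type, Finset.sum_eq_single p.1]
  · by_cases hp : p.1 = p'.1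
    · simp only [hp, and_self, if_true]
      rw [hχ]
      congr 1
      rw [eq_iff_iff, Prod.ext_iff]
      simp [hp]
    · have : p ≠ p' := fun h => hp (congrArg Prod.fst h)
      simp [hp, this]
  · intro r _ hr
    simp [hr]
  · simp

lemma scrambledState_eq {Q : Type} [Fintype Q] (a : T) (χ : Qubits {t // t ≠ a} × Qubits Q → ℂ)
    (U : unitaryGroup (Qubits T) ℂ) (φ : Fin 2 × Fin 2 → ℂ) (r : Fin 2) (t : Qubits T)
    (m : Qubits Q) : scrambledState a χ U φ (r, t, m) =
      ∑ s, φ (r, s) * ∑ y, (U : Matrix _ _ ℂ) t y * inputVector a χ (s, m) y := by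
  unfold scrambledState inputVector
  simp_rw [Finset.mul_sum]
  rw [Finset.sum_comm]
  refine Finset.sum_congr rfl fun y _ => ?_
  rw [Finset.sum_eq_single (y a)]
  · simp
    ring
  · intro s _ hs
    simp [Ne.symm hs]
  · simp

variable {X Z : Type} [Fintype X] [Fintype Z] (e : X × Z ≃ Qubits T)
  {v : Fin 2 × M → Qubits T → ℂ}

lemma isEncodingAmplitude_codeAmplitude [Nonempty M]
    (hv : ∀ p p', ∑ y, v p y * star (v p' y) =
      if p = p' then (((Fintype.card M : ℝ)⁻¹ : ℝ) : ℂ) else 0)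
    (U : unitaryGroup (Qubits T) ℂ) : IsEncodingAmplitude (codeAmplitude e v U) := by
  intro r r'
  have hU : ∀ w w' : Qubits T → ℂ, ∑ t, (∑ y, (U : Matrix (Qubits T) (Qubits T) ℂ) t y * w y) *
      star (∑ y, (U : Matrix (Qubits T) (Qubits T) ℂ) t y * w' y) = ∑ y, w y * star (w' y) := by
    intro w w'
    have h1 : (U : Matrix (Qubits T) (Qubits T) ℂ)ᴴ * (U : Matrix _ _ ℂ) = 1 :=
      Unitary.coe_star_mul_self U
    change ((U : Matrix (Qubits T) (Qubits T) ℂ) *ᵥ w) ⬝ᵥ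
      star ((U : Matrix (Qubits T) (Qubits T) ℂ) *ᵥ w') = w ⬝ᵥ star w'
    rw [star_mulVec, dotProduct_comm, ← dotProduct_mulVec, mulVec_mulVec, h1, one_mulVec,
      dotProduct_comm]
  calc ∑ x, ∑ q : Z × M, codeAmplitude e v U (r, x) q * star (codeAmplitude e v U (r', x) q)
      = ∑ m, ∑ p : X × Z, (∑ y, (U : Matrix _ _ ℂ) (e p) y * v (r, m) y) *
          star (∑ y, (U : Matrix _ _ ℂ) (e p) y * v (r', m) y) := by
        simp_rw [Fintype.sum_prod_type_right (γ := ℂ) (α₁ := Z) (α₂ := M)]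
        rw [Finset.sum_comm]
        refine Finset.sum_congr rfl fun m _ => ?_
        rw [Fintype.sum_prod_type]
        rfl
    _ = ∑ m, ∑ y, v (r, m) y * star (v (r', m) y) := by
        refine Finset.sum_congr rfl fun m _ => ?_
        rw [e.sum_comp (fun t => (∑ y, (U : Matrix _ _ ℂ) t y * v (r, m) y) *
          star (∑ y, (U : Matrix _ _ ℂ) t y * v (r', m) y)), hU]
    _ = _ := by
        simp_rw [hv, Prod.mk.injEq, and_true]
        split_ifs
        · rw [Finset.sum_const, Finset.card_univ, nsmul_eq_mul]
          have : (Fintype.card M : ℂ) ≠ 0 := by exact_mod_cast Fintype.card_ne_zero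
          push_cast
          exact mul_inv_cancel₀ this
        · simp

lemma haar_not_isDominated_le [Nonempty M] [Nonempty Z]
    (hv : ∀ p p', ∑ y, v p y * star (v p' y) =
      if p = p' then (((Fintype.card M : ℝ)⁻¹ : ℝ) : ℂ) else 0)
    {η τ : ℝ} (hη : 0 < η) (hτ : 0 < τ) (hτ1 : τ < 1) (k : ℕ) :
    haarUnitary (Qubits T) {U | ¬ IsDominated (codeAmplitude e v U) ((1 + η) / (1 - τ) ^ 2)} ≤
      ENNReal.ofReal (((1 + 2 / τ) ^ 2) ^ (2 * Fintype.card X) *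
        ((1 + 4 * k / (Fintype.card Z * Fintype.card M : ℕ)) / (1 + η)) ^ k) := by
  classical
  have hM : 0 < (Fintype.card M : ℝ) := by exact_mod_cast Fintype.card_pos
  have h := haar_exists_codeAmplitude_gt_le (ι := Fin 2) e v (inv_pos.2 hM) hv hη hτ hτ1 k
  rw [Fintype.card_fin] at h
  push_cast
  refine le_trans (measure_mono ?_) h
  intro U hU
  simp only [Set.mem_ofPred_eq, IsDominated, not_forall, not_le] at hU ⊢
  obtain ⟨ξ, hξ⟩ := hU
  refine ⟨ξ, lt_of_eq_of_lt ?_ hξ⟩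
  rw [inv_mul_cancel₀ hM.ne']
  ring

lemma haar_not_isDominated_swap_le [Nonempty X] [Nonempty M]
    (hv : ∀ p p', ∑ y, v p y * star (v p' y) =
      if p = p' then (((Fintype.card M : ℝ)⁻¹ : ℝ) : ℂ) else 0)
    {η τ : ℝ} (hη : 0 < η) (hτ : 0 < τ) (hτ1 : τ < 1) (k : ℕ) :
    haarUnitary (Qubits T)
        {U | ¬ IsDominated (swapAmplitude (codeAmplitude e v U)) ((1 + η) / (1 - τ) ^ 2)} ≤
      ENNReal.ofReal (((1 + 2 / τ) ^ 2) ^ (2 * (Fintype.card Z * Fintype.card M)) *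
        ((1 + 4 * k / (Fintype.card X : ℕ)) / (1 + η)) ^ k) := by
  classical
  have hM : 0 < (Fintype.card M : ℝ) := by exact_mod_cast Fintype.card_pos
  have h := haar_exists_codeAmplitude_gt_le (ι := Fin 2 × M) (M := Unit)
    ((Equiv.prodComm Z X).trans e) (fun p => v p.1) (inv_pos.2 hM)
    (fun p p' => (hv p.1 p'.1).trans (by simp [Prod.ext_iff])) hη hτ hτ1 k
  have hexp : Fintype.card (Fin 2 × M) * Fintype.card Z =
      2 * (Fintype.card Z * Fintype.card M) := by
    rw [Fintype.card_prod, Fintype.card_fin]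
    ring
  rw [hexp, Fintype.card_unit, Nat.cast_one, mul_one, mul_one] at h
  refine le_trans (measure_mono ?_) h
  intro U hU
  simp only [Set.mem_ofPred_eq, IsDominated, not_forall, not_le] at hU ⊢
  obtain ⟨ξ, hξ⟩ := hU
  let f : (Fin 2 × M) × Z ≃ Fin 2 × (Z × M) :=
    (Equiv.prodAssoc (Fin 2) M Z).trans ((Equiv.refl (Fin 2)).prodCongr (Equiv.prodComm M Z))
  refine ⟨fun p => ξ (f p), ?_⟩
  have h1 : ∑ p, ‖ξ (f p)‖ ^ 2 = ∑ p, ‖ξ p‖ ^ 2 := f.sum_comp fun p => ‖ξ p‖ ^ 2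
  have h2 : ∀ q : X × Unit, ∑ p, ξ (f p) * codeAmplitude ((Equiv.prodComm Z X).trans e)
      (fun p : (Fin 2 × M) × Unit => v p.1) (U : Matrix _ _ ℂ) p q =
      ∑ p, ξ p * swapAmplitude (codeAmplitude e v (U : Matrix _ _ ℂ)) p q.1 := fun q =>
    f.sum_comp fun p => ξ p * swapAmplitude (codeAmplitude e v (U : Matrix _ _ ℂ)) p q.1
  rw [h1, Finset.sum_congr rfl fun q _ => congrArg (fun w : ℂ => ‖w‖ ^ 2) (h2 q)]
  refine lt_of_lt_of_eq (lt_of_eq_of_lt ?_ hξ)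
    ((Equiv.prodPUnit X).sum_comp fun z => ‖∑ p, ξ p *
      swapAmplitude (codeAmplitude e v (U : Matrix _ _ ℂ)) p z‖ ^ 2).symm
  rw [Fintype.card_prod]
  push_cast
  field_simp

end

/-! ### From dominated amplitudes to secret sharing -/

lemma trace_of_mul_conjTranspose {φ : Fin 2 × Fin 2 → ℂ} (hφ : IsUnitVector φ) :
    trace ((Matrix.of fun r s => φ (r, s)) * (Matrix.of fun r s => φ (r, s))ᴴ) = 1 := by
  have h : ((∑ p : Fin 2 × Fin 2, ‖φ p‖ ^ 2 : ℝ) : ℂ) = 1 := by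
    rw [show ∑ p : Fin 2 × Fin 2, ‖φ p‖ ^ 2 = 1 from hφ, Complex.ofReal_one]
  rw [← h, Complex.ofReal_sum, Fintype.sum_prod_type]
  simp only [trace, Matrix.diag, Matrix.mul_apply, conjTranspose_apply, Matrix.of_apply]
  refine Finset.sum_congr rfl fun r _ => Finset.sum_congr rfl fun s _ => ?_
  rw [Complex.ofReal_pow, ← Complex.mul_conj']
  rfl

/-- Union bound over the sets of players, for the two requirements on a ramp scheme. -/
lemma measure_not_isApproxRampScheme_le {P Q Ω : Type} [Fintype P] [DecidableEq P] [Fintype Q]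
    [DecidableEq Q] [MeasurableSpace Ω] (μ : Measure Ω) (E : Ω → Encoding P Q) {b g γ t : ℝ}
    (B₁ B₂ : Finset P → Set Ω)
    (h₁ : ∀ C : Finset P, (C.card : ℝ) ≤ b → μ (B₁ C) ≤ ENNReal.ofReal t)
    (h₂ : ∀ C : Finset P, g ≤ (C.card : ℝ) → μ (B₂ C) ≤ ENNReal.ofReal t)
    (H₁ : ∀ C U, U ∉ B₁ C → ∀ φ, IsUnitVector φ →
      mutualInfo (restrictPlayers C (discardPurifier (E U φ))) ≤ γ)
    (H₂ : ∀ C U, U ∉ B₂ C → ∀ φ, IsUnitVector φ → mutualInfo (pureDensity φ) - γ ≤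
      mutualInfo (restrictPlayers C (discardPurifier (E U φ)))) :
    μ {U | ¬ IsApproxRampScheme (E U) b g γ} ≤
      ENNReal.ofReal (2 ^ (Fintype.card P + 1) * t) := by
  classical
  have hsub : {U | ¬ IsApproxRampScheme (E U) b g γ} ⊆ ⋃ C ∈ (Finset.univ : Finset (Finset P)),
      ((if (C.card : ℝ) ≤ b then B₁ C else ∅) ∪ (if g ≤ (C.card : ℝ) then B₂ C else ∅)) := by
    intro U hU
    by_contra hcon
    simp only [Set.mem_iUnion, Finset.mem_univ, exists_true_left, not_exists, Set.mem_union,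
      not_or] at hcon
    refine hU fun φ hφ C => ⟨fun hC => H₁ C U ?_ φ hφ, fun hC => H₂ C U ?_ φ hφ⟩
    · have := (hcon C).1
      rwa [if_pos hC] at this
    · have := (hcon C).2
      rwa [if_pos hC] at this
  refine (measure_mono hsub).trans ((measure_biUnion_finset_le _ _).trans ?_)
  have hC : ∀ C ∈ (Finset.univ : Finset (Finset P)),
      μ ((if (C.card : ℝ) ≤ b then B₁ C else ∅) ∪ (if g ≤ (C.card : ℝ) then B₂ C else ∅)) ≤
        2 * ENNReal.ofReal t := by
    intro C _
    refine (measure_union_le _ _).trans ?_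
    rw [two_mul]
    refine add_le_add ?_ ?_
    · split_ifs with h
      exacts [h₁ C h, by simp]
    · split_ifs with h
      exacts [h₂ C h, by simp]
  refine (Finset.sum_le_sum hC).trans_eq ?_
  rw [Finset.sum_const, Finset.card_univ, Fintype.card_finset, nsmul_eq_mul,
    ENNReal.ofReal_mul (by positivity), ENNReal.ofReal_pow (by norm_num), pow_succ, ← mul_assoc]
  simp

/-! ### Choice of the constants -/

lemma exists_slack {γ : ℝ} (hγ : 0 < γ) :
    ∃ t : ℝ, 0 < t ∧ t < 1 ∧ Real.log ((1 + t) / (1 - t) ^ 2) / Real.log 2 ≤ γ := by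
  have hc : ContinuousAt (fun t : ℝ => Real.log ((1 + t) / (1 - t) ^ 2) / Real.log 2) 0 := by
    refine ContinuousAt.div_const (ContinuousAt.log (ContinuousAt.div (by fun_prop) (by fun_prop)
      (by norm_num)) (by norm_num)) _
  have h1 : ∀ᶠ t in nhds (0 : ℝ), Real.log ((1 + t) / (1 - t) ^ 2) / Real.log 2 < γ :=
    hc.eventually_lt_const (by simpa using hγ)
  have h2 := (h1.filter_mono (nhdsWithin_le_nhds (s := Set.Ioi 0))).and
    (Ioo_mem_nhdsGT (zero_lt_one' ℝ))
  obtain ⟨t, ht, ht1⟩ := h2.exists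
  exact ⟨t, ht1.1, ht1.2, ht.le⟩

/-- The moment `k ≈ η L / 8` beats the size `B ^ (2 D)` of the net and the number of sets of
players as soon as `L / D` exceeds a constant and `D * L = 2 ^ n` is large. -/
lemma exists_threshold {B η : ℝ} (hB : 1 ≤ B) (hη : 0 < η) :
    ∃ r : ℕ, 0 < r ∧ ∀ δ : ℝ, 0 < δ → ∃ n₀ : ℕ, ∀ n i : ℕ, n₀ ≤ n → 2 * i + 2 * r ≤ n →
      ∃ k : ℕ, B ^ (2 * 2 ^ i) * ((1 + 4 * k / (2 ^ (n - i) : ℕ)) / (1 + η)) ^ k ≤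
        δ / 2 ^ (n + 1) := by
  set q : ℝ := (1 + η / 2) / (1 + η) with hq
  have hq0 : 0 < q := by positivity
  have hq1 : q < 1 := by
    rw [hq, div_lt_one (by positivity)]
    linarith
  set β := -Real.log q with hβ
  have hβ0 : 0 < β := neg_pos.2 (Real.log_neg hq0 hq1)
  have hlB : 0 ≤ Real.log B := Real.log_nonneg hB
  obtain ⟨r, hr⟩ := pow_unbounded_of_one_lt (32 * Real.log B / (β * η)) (one_lt_two (α := ℝ))
  refine ⟨r + 1, Nat.succ_pos r, fun δ hδ => ?_⟩
  have hlim : Filter.Tendsto (fun j : ℕ => ((2 * Real.log 2) * ((j : ℝ) ^ 1 / 2 ^ j) +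
      (2 * Real.log 2 + β - Real.log δ) * (1 / 2) ^ j : ℝ)) Filter.atTop
      (nhds ((2 * Real.log 2) * 0 + (2 * Real.log 2 + β - Real.log δ) * 0)) :=
    ((tendsto_pow_const_div_const_pow_of_one_lt 1 one_lt_two).const_mul _).add
      ((tendsto_pow_atTop_nhds_zero_of_lt_one (by norm_num) (by norm_num)).const_mul _)
  rw [mul_zero, mul_zero, add_zero] at hlim
  obtain ⟨j₀, hj₀⟩ := Filter.eventually_atTop.1
    (hlim.eventually_le_const (show 0 < β * η / 16 by positivity))
  refine ⟨2 * j₀, fun n i hn hi => ?_⟩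
  set L : ℝ := ((2 ^ (n - i) : ℕ) : ℝ) with hL
  have hLpow : L = 2 ^ (n - i) := by rw [hL]; push_cast; rfl
  have hL0 : 0 < L := by rw [hLpow]; positivity
  have hk1 : (⌊η * L / 8⌋₊ : ℝ) ≤ η * L / 8 := Nat.floor_le (by positivity)
  have hk2 : η * L / 8 - 1 < (⌊η * L / 8⌋₊ : ℝ) := Nat.sub_one_lt_floor _
  refine ⟨⌊η * L / 8⌋₊, ?_⟩
  generalize ⌊η * L / 8⌋₊ = k at *
  have hT : (1 + 4 * k / L) / (1 + η) ≤ q := by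
    rw [hq]
    refine div_le_div_of_nonneg_right ?_ (by positivity)
    have : 4 * k / L ≤ η / 2 := by
      rw [div_le_iff₀ hL0]
      linarith
    linarith
  -- the two lower bounds on `L`, by a constant times the net dimension and by `2 ^ (n / 2)`
  have hLD : (2 : ℝ) ^ r * 2 ^ i ≤ L := by
    rw [hLpow, ← pow_add]
    exact pow_le_pow_right₀ one_le_two (by omega)
  have hLn : (2 : ℝ) ^ (n / 2) ≤ L := by
    rw [hLpow]
    exact pow_le_pow_right₀ one_le_two (by omega)
  have hnet : 2 * 2 ^ i * Real.log B ≤ β * η / 16 * L := by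
    have h1 : 32 * Real.log B ≤ 2 ^ r * (β * η) := by
      have := hr.le
      rwa [div_le_iff₀ (by positivity)] at this
    have h2 : (2 : ℝ) ^ i * (32 * Real.log B) ≤ L * (β * η) :=
      (mul_le_mul_of_nonneg_left h1 (by positivity)).trans
        ((mul_le_mul_of_nonneg_right hLD (by positivity)).trans' (by ring_nf; rfl))
    linarith
  have hsets : (n + 1) * Real.log 2 + β - Real.log δ ≤ β * η / 16 * L := by
    have h1 := hj₀ (n / 2) (by omega)
    have h2 : (0 : ℝ) < 2 ^ (n / 2) := by positivity
    have h3 := mul_le_mul_of_nonneg_right h1 h2.le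
    have h4 : ((2 * Real.log 2) * (((n / 2 : ℕ) : ℝ) ^ 1 / 2 ^ (n / 2)) +
        (2 * Real.log 2 + β - Real.log δ) * (1 / 2) ^ (n / 2)) * 2 ^ (n / 2) =
        2 * Real.log 2 * ((n / 2 : ℕ) : ℝ) + (2 * Real.log 2 + β - Real.log δ) := by
      rw [one_div, inv_pow]
      field_simp
    rw [h4] at h3
    have h5 : (n : ℝ) ≤ 2 * ((n / 2 : ℕ) : ℝ) + 1 := by
      have : n ≤ 2 * (n / 2) + 1 := by omega
      exact_mod_cast this
    have h6 := mul_le_mul_of_nonneg_right h5 (Real.log_nonneg one_le_two)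
    have h7 := mul_le_mul_of_nonneg_left hLn (show 0 ≤ β * η / 16 by positivity)
    linarith
  have hB0 : 0 < B := by linarith
  calc B ^ (2 * 2 ^ i) * ((1 + 4 * k / L) / (1 + η)) ^ k ≤ B ^ (2 * 2 ^ i) * q ^ k := by
        gcongr
    _ = Real.exp (2 * 2 ^ i * Real.log B - β * k) := by
        rw [sub_eq_add_neg, Real.exp_add, ← Real.exp_log (pow_pos hB0 (2 * 2 ^ i)),
          ← Real.exp_log (pow_pos hq0 k), Real.log_pow, Real.log_pow, hβ]
        congr 2
        · push_cast
          ring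
        · ring
    _ ≤ Real.exp (Real.log δ - (n + 1) * Real.log 2) := by
        refine Real.exp_le_exp.2 ?_
        have h1 := mul_lt_mul_of_pos_left hk2 hβ0
        have h2 : β * (η * L / 8 - 1) = 2 * (β * η / 16 * L) - β := by ring
        linarith
    _ = δ / 2 ^ (n + 1) := by
        rw [Real.exp_sub, Real.exp_log hδ]
        congr 1
        rw [← Nat.cast_one, ← Nat.cast_add, ← Real.log_pow, Real.exp_log (by positivity)]

/-! ### Random scrambling gives a ramp scheme -/

lemma card_qubits (P : Type) [Fintype P] [DecidableEq P] :
    Fintype.card (Qubits P) = 2 ^ Fintype.card P := by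
  rw [Fintype.card_fun, Fintype.card_fin]

/-- Scrambling of the qubits `T`, with a memory `M`, where for every set `C` of players the qubits
`T` split into those of `C` and a discarded register `Z C`. -/
lemma haar_not_isApproxRampScheme_le {P Q T M : Type} [Fintype P] [DecidableEq P] [Fintype Q]
    [DecidableEq Q] [Fintype T] [DecidableEq T] [Fintype M] [DecidableEq M] {n : ℕ}
    (hn : Fintype.card T + Fintype.card M = n) (hP : Fintype.card P ≤ n) (a : T)
    {χ : Qubits {t // t ≠ a} × Qubits M → ℂ}
    (hχ : ∀ m m', ∑ b, χ (b, m) * star (χ (b, m')) =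
      if m = m' then (((Fintype.card (Qubits M) : ℝ)⁻¹ : ℝ) : ℂ) else 0)
    (E : unitaryGroup (Qubits T) ℂ → Encoding P Q) {Z : Finset P → Type} [∀ C, Fintype (Z C)]
    [∀ C, Nonempty (Z C)] (e : ∀ C : Finset P, Qubits {p // p ∈ C} × Z C ≃ Qubits T)
    (hE : ∀ (U : unitaryGroup (Qubits T) ℂ) (φ : Fin 2 × Fin 2 → ℂ) (C : Finset P),
      restrictPlayers C (discardPurifier (E U φ)) =
        ((Matrix.of fun r s => φ (r, s)) ⊗ₖ (1 : Matrix (Qubits C) (Qubits C) ℂ) *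
          codeAmplitude (e C) (inputVector a χ) U) *
        ((Matrix.of fun r s => φ (r, s)) ⊗ₖ (1 : Matrix (Qubits C) (Qubits C) ℂ) *
          codeAmplitude (e C) (inputVector a χ) U)ᴴ)
    {t γ : ℝ} (ht0 : 0 < t) (ht1 : t < 1)
    (htγ : Real.log ((1 + t) / (1 - t) ^ 2) / Real.log 2 ≤ γ) {r : ℕ} {δ : ℝ} (hδ : 0 < δ)
    (hk : ∀ i : ℕ, 2 * i + 2 * r ≤ n → ∃ k : ℕ, ((1 + 2 / t) ^ 2) ^ (2 * 2 ^ i) *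
      ((1 + 4 * k / (2 ^ (n - i) : ℕ)) / (1 + t)) ^ k ≤ δ / 2 ^ (n + 1)) :
    haarUnitary (Qubits T) {U | ¬ IsApproxRampScheme (E U) ((n : ℝ) / 2 - r) ((n : ℝ) / 2 + r) γ} ≤
      ENNReal.ofReal δ := by
  classical
  have hv := sum_inputVector_mul_star a hχ
  have hc : 0 < (1 + t) / (1 - t) ^ 2 := by
    have : 0 < 1 - t := by linarith
    positivity
  have hX : ∀ C : Finset P, Fintype.card (Qubits {p // p ∈ C}) = 2 ^ C.card := by
    intro C
    rw [card_qubits, Fintype.card_coe]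
  have hcard : ∀ C : Finset P, 2 ^ C.card * (Fintype.card (Z C) * Fintype.card (Qubits M)) =
      2 ^ n := by
    intro C
    rw [← hX, ← mul_assoc, ← Fintype.card_prod, Fintype.card_congr (e C), card_qubits,
      card_qubits, ← pow_add, hn]
  have hCn : ∀ C : Finset P, C.card ≤ n := fun C => (Finset.card_le_univ C).trans hP
  have hZ : ∀ C : Finset P, Fintype.card (Z C) * Fintype.card (Qubits M) = 2 ^ (n - C.card) := by
    intro C
    refine Nat.eq_of_mul_eq_mul_left (pow_pos two_pos C.card) ?_
    rw [hcard, ← pow_add, Nat.add_sub_cancel' (hCn C)]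
  refine (measure_not_isApproxRampScheme_le (haarUnitary (Qubits T)) E (t := δ / 2 ^ (n + 1))
    (fun C => {U | ¬ IsDominated (codeAmplitude (e C) (inputVector a χ) U)
      ((1 + t) / (1 - t) ^ 2)})
    (fun C => {U | ¬ IsDominated (swapAmplitude (codeAmplitude (e C) (inputVector a χ) U))
      ((1 + t) / (1 - t) ^ 2)}) ?_ ?_ ?_ ?_).trans ?_
  · intro C hC
    have h1 : 2 * C.card + 2 * r ≤ n := by
      have : (2 * C.card + 2 * r : ℝ) ≤ n := by linarith
      exact_mod_cast this
    obtain ⟨k, hk⟩ := hk C.card h1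
    have h2 := haar_not_isDominated_le (e C) hv ht0 ht0 ht1 k
    rw [hX, hZ] at h2
    exact h2.trans (ENNReal.ofReal_le_ofReal hk)
  · intro C hC
    have h1 : 2 * (n - C.card) + 2 * r ≤ n := by
      have h3 : (n : ℝ) + 2 * r ≤ 2 * C.card := by linarith
      have h4 : n + 2 * r ≤ 2 * C.card := by exact_mod_cast h3
      have := hCn C
      omega
    obtain ⟨k, hk⟩ := hk (n - C.card) h1
    have h2 := haar_not_isDominated_swap_le (e C) hv ht0 ht0 ht1 k
    rw [hX, hZ] at h2
    rw [Nat.sub_sub_self (hCn C)] at hk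
    exact h2.trans (ENNReal.ofReal_le_ofReal hk)
  · intro C U hU φ hφ
    rw [hE]
    exact (mutualInfo_le_of_isDominated (isEncodingAmplitude_codeAmplitude (e C) hv U) hc
      (not_not.1 hU) (trace_of_mul_conjTranspose hφ)).trans htγ
  · intro C U hU φ hφ
    rw [hE]
    have h1 := le_mutualInfo_of_isDominated_swap (isEncodingAmplitude_codeAmplitude (e C) hv U) hc
      (not_not.1 hU) (trace_of_mul_conjTranspose hφ)
    have h2 := mutualInfo_pureDensity_le (trace_of_mul_conjTranspose hφ)
    linarith
  · refine ENNReal.ofReal_le_ofReal ?_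
    rw [mul_div_assoc', div_le_iff₀ (by positivity), mul_comm]
    have : (2 : ℝ) ^ (Fintype.card P + 1) ≤ 2 ^ (n + 1) :=
      pow_le_pow_right₀ one_le_two (by omega)
    gcongr

section

variable {P Q : Type} [Fintype P] [DecidableEq P] [Fintype Q] [DecidableEq Q]

/-- A basis label of all players is a label of those in `C` together with one of the others. -/
def mergeEquiv (C : Finset P) : Qubits {p // p ∈ C} × Qubits {p // p ∉ C} ≃ Qubits P :=
  (Equiv.piEquivPiSubtypeProd (fun p => p ∈ C) fun _ => Fin 2).symm

/-- The same for a set `C` of players in `P`, when the qubits of `P` and `Q` are scrambled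
jointly. -/
def jointMergeEquiv (C : Finset P) :
    Qubits {p // p ∈ C} × (Qubits {p // p ∉ C} × Qubits Q) ≃ Qubits (P ⊕ Q) :=
  (Equiv.prodAssoc _ _ _).symm.trans
    (((mergeEquiv C).prodCongr (Equiv.refl _)).trans (Equiv.sumArrowEquivProdArrow P Q (Fin 2)).symm)

lemma restrictPlayers_memoryEncoding (a : P) (χ : Qubits {p // p ≠ a} × Qubits Q → ℂ)
    (U : unitaryGroup (Qubits P) ℂ) (φ : Fin 2 × Fin 2 → ℂ) (C : Finset P) :
    restrictPlayers C (discardPurifier (memoryEncoding a χ U φ)) =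
      ((Matrix.of fun r s => φ (r, s)) ⊗ₖ (1 : Matrix (Qubits C) (Qubits C) ℂ) *
        codeAmplitude (mergeEquiv C) (inputVector a χ) U) *
      ((Matrix.of fun r s => φ (r, s)) ⊗ₖ (1 : Matrix (Qubits C) (Qubits C) ℂ) *
        codeAmplitude (mergeEquiv C) (inputVector a χ) U)ᴴ := by
  ext ⟨r, u⟩ ⟨r', u'⟩
  rw [Matrix.mul_apply, Fintype.sum_prod_type]
  refine Finset.sum_congr rfl fun z _ => Finset.sum_congr rfl fun q _ => ?_
  rw [conjTranspose_apply, kronecker_one_mul_apply, kronecker_one_mul_apply]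
  simp only [memoryEncoding, scrambledState_eq]
  rfl

lemma restrictPlayers_jointEncoding (a : P ⊕ Q) (χ : Qubits {t // t ≠ a} → ℂ)
    (U : unitaryGroup (Qubits (P ⊕ Q)) ℂ) (φ : Fin 2 × Fin 2 → ℂ) (C : Finset P) :
    restrictPlayers C (discardPurifier (jointEncoding a χ U φ)) =
      ((Matrix.of fun r s => φ (r, s)) ⊗ₖ (1 : Matrix (Qubits C) (Qubits C) ℂ) *
        codeAmplitude (jointMergeEquiv C)
          (inputVector a fun y : Qubits {t // t ≠ a} × Qubits Empty => χ y.1) U) *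
      ((Matrix.of fun r s => φ (r, s)) ⊗ₖ (1 : Matrix (Qubits C) (Qubits C) ℂ) *
        codeAmplitude (jointMergeEquiv C)
          (inputVector a fun y : Qubits {t // t ≠ a} × Qubits Empty => χ y.1) U)ᴴ := by
  ext ⟨r, u⟩ ⟨r', u'⟩
  rw [Matrix.mul_apply, Fintype.sum_prod_type, Fintype.sum_prod_type]
  refine Finset.sum_congr rfl fun z _ => Finset.sum_congr rfl fun q _ => ?_
  rw [Fintype.sum_eq_single (Empty.elim : Qubits Empty) fun w hw =>
    absurd (Subsingleton.elim w _) hw]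
  rw [conjTranspose_apply, kronecker_one_mul_apply, kronecker_one_mul_apply]
  simp only [jointEncoding, scrambledState_eq]
  rfl

end

end

theorem theorem2 :
    ∀ γ : ℝ, 0 < γ → ∃ ε : ℝ, 0 < ε ∧ ∀ δ : ℝ, 0 < δ → ∃ n₀ : ℕ, ∀ N s : ℕ, n₀ ≤ N + s →
      (∀ (a : Fin N ⊕ Fin s) (χ : Qubits {t // t ≠ a} → ℂ), IsUnitVector χ →
        haarUnitary (Qubits (Fin N ⊕ Fin s))
            {U | ¬ IsApproxRampScheme (jointEncoding a χ U)
                    (((N : ℝ) + s) / 2 - ε) (((N : ℝ) + s) / 2 + ε) γ}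
          ≤ ENNReal.ofReal δ) ∧
      (∀ (a : Fin N) (χ : Qubits {t // t ≠ a} × Qubits (Fin s) → ℂ), IsMaximallyEntangledWith χ →
        haarUnitary (Qubits (Fin N))
            {U | ¬ IsApproxRampScheme (memoryEncoding a χ U)
                    (((N : ℝ) + s) / 2 - ε) (((N : ℝ) + s) / 2 + ε) γ}
          ≤ ENNReal.ofReal δ) := by
  intro γ hγ
  obtain ⟨t, ht0, ht1, htγ⟩ := exists_slack hγ
  have hB : 1 ≤ (1 + 2 / t) ^ 2 := one_le_pow₀ (by
    have : 0 < 2 / t := by positivity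
    linarith)
  obtain ⟨r, hr0, hr⟩ := exists_threshold hB ht0
  refine ⟨r, by exact_mod_cast hr0, fun δ hδ => ?_⟩
  obtain ⟨n₀, hn₀⟩ := hr δ hδ
  refine ⟨n₀, fun N s hNs => ?_⟩
  have hk := fun i => hn₀ (N + s) i hNs
  rw [← Nat.cast_add]
  constructor
  · intro a χ hχ
    refine haar_not_isApproxRampScheme_le (M := Empty) (by simp) (by simp) a ?_ _
      jointMergeEquiv (restrictPlayers_jointEncoding a χ) ht0 ht1 htγ hδ hk
    intro m m'
    have h : ((∑ b, ‖χ b‖ ^ 2 : ℝ) : ℂ) = 1 := by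
      rw [show ∑ b, ‖χ b‖ ^ 2 = 1 from hχ, Complex.ofReal_one]
    rw [if_pos (Subsingleton.elim m m'), card_qubits, Fintype.card_empty]
    simp only [pow_zero, Nat.cast_one, inv_one, Complex.ofReal_one]
    rw [← h, Complex.ofReal_sum]
    refine Finset.sum_congr rfl fun b _ => ?_
    rw [Complex.ofReal_pow, ← Complex.mul_conj']
    rfl
  · intro a χ hχ
    refine haar_not_isApproxRampScheme_le (by simp) (by simp) a ?_ _
      mergeEquiv (restrictPlayers_memoryEncoding a χ) ht0 ht1 htγ hδ hk
    intro m m'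
    have h := congrFun (congrFun hχ m) m'
    simp only [traceFst, pureDensity] at h
    rw [h, card_qubits, Matrix.smul_apply, Matrix.one_apply]
    split_ifs <;> simp
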